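/- Let $M$ be a smooth 3-manifold (Hausdorff, second countable, without boundary), let $m \ge 1$, and let $Z \subset M$ be a closed subset that is a hypersurface with a defining function $f$: $f$ is smooth on a neighbourhood of $Z$, in which $Z = f^{-1}(0)$, and $df \neq 0$ along $Z$. (A global defining function $f : M \to \mathbb{R}$ is a special case.) A $b^m$-vector field is a smooth vector field $X$ on $M$ such that $X(f) = f^m g$ near $Z$ for some smooth function $g$; the $b^m$-vector fields are the sections of a rank-3 vector bundle, the $b^m$-tangent bundle. A $b^m$-form $\alpha$ of degree one is a section of its dual, that is, a $C^\infty(M)$-linear map from $b^m$-vector fields to $C^\infty(M)$, and $d\alpha(X,Y) = X(\alpha(Y)) - Y(\alpha(X)) - \alpha([X,Y])$ for $b^m$-vector fields $X, Y$. The form $\alpha$ is a $b^m$-contact form if $\alpha \wedge d\alpha$ is nowhere zero as a section of the third exterior power of the $b^m$-cotangent bundle; its Reeb vector field is the $b^m$-vector field $R$ with $\alpha(R) = 1$ and $d\alpha(R, \cdot) = 0$. Proposition. Let $\alpha$ be a $b^m$-contact form on $(M, Z, f)$ with Reeb vector field $R$, and assume that the critical hypersurface $Z$ is non-empty and closed as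 a manifold, i.e. compact (without boundary). Then there are infinitely many distinct non-constant periodic orbits of $R$ contained in $Z$. -/

import Mathlib

open Set Filter Topology VectorField
open scoped Manifold ContDiff

noncomputable section

namespace BmContact

/-! Smooth functions and vector fields on a 3-manifold. -/

section Calculus

variable {M : Type*} [TopologicalSpace M] [ChartedSpace (EuclideanSpace ℝ (Fin 3)) M]

variable (M) in
/-- The ring of smooth real functions on `M`. -/
abbrev SmoothFun : Type _ := C^∞⟮𝓡 3, M; 𝓘(ℝ, ℝ), ℝ⟯

variable (M) in
/-- Arbitrary (not necessarily continuous) vector fields on `M`. -/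
abbrev RawField : Type _ := (p : M) → TangentSpace (𝓡 3) p

/-- Vector fields form a module over the smooth functions, `(g • X) p = g p • X p`. -/
instance rawFieldModule : Module (SmoothFun M) (RawField M) :=
  Module.compHom (RawField M)
    (ContMDiffMap.coeFnRingHom : SmoothFun M →+* (M → ℝ))

theorem smul_eq (g : SmoothFun M) (X : RawField M) : g • X = (g : M → ℝ) • X := rfl

/-- The derivative `X(g) = dg(X)` of a function along a vector field. -/
def along (X : RawField M) (g : M → ℝ) (p : M) : ℝ :=
  mvfderiv (𝓡 3) g p (X p)

variable [IsManifold (𝓡 3) ∞ M]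

/-- `X` is a smooth vector field. -/
def SmoothField (X : RawField M) : Prop :=
  ContMDiff (𝓡 3) (𝓡 3).tangent ∞
    (fun p ↦ (⟨p, X p⟩ : TangentBundle (𝓡 3) M))

theorem smooth_along {X : RawField M} (hX : SmoothField X) {g : M → ℝ} {p : M}
    (hg : ContMDiffAt (𝓡 3) 𝓘(ℝ, ℝ) ∞ g p) :
    ContMDiffAt (𝓡 3) 𝓘(ℝ, ℝ) ∞ (along X g) p := by
  have h1 := ContMDiffAt.mfderiv_const (m := ∞) hg (by simp)
  have h2 := ContMDiffAt.clm_apply_of_inCoordinates h1 (hX p) hg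
  exact (contMDiff_snd_tangentBundle_modelSpace ℝ 𝓘(ℝ, ℝ)).contMDiffAt.comp p h2

theorem mdiffAt_of_smooth {X : RawField M} (hX : SmoothField X) (p : M) :
    MDifferentiableAt (𝓡 3) (𝓡 3).tangent
      (fun p ↦ (⟨p, X p⟩ : TangentBundle (𝓡 3) M)) p :=
  (show ContMDiff _ _ _ _ from hX).contMDiffAt.mdifferentiableAt (by simp)

theorem smooth_bracket {X Y : RawField M} (hX : SmoothField X) (hY : SmoothField Y) :
    SmoothField (mlieBracket (𝓡 3) X Y) := by
  have : IsManifold (𝓡 3) (minSmoothness ℝ 2) M := by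
    rw [minSmoothness_of_isRCLikeNormedField]; infer_instance
  have : IsManifold (𝓡 3) (((⊤ : ℕ∞) : WithTop ℕ∞) + 1) M := by simpa using ‹IsManifold (𝓡 3) ∞ M›
  exact ContDiff.mlieBracket_vectorField (m := ⊤) (n := ⊤) hX hY (by simp)

theorem bracket_smul {Y W : RawField M} (hW : SmoothField W)
    {g : M → ℝ} {p : M} (hg : MDifferentiableAt (𝓡 3) 𝓘(ℝ, ℝ) g p) :
    mlieBracket (𝓡 3) Y (g • W) p = along Y g p • W p + g p • mlieBracket (𝓡 3) Y W p :=
  have : IsManifold (𝓡 3) 2 M := inferInstance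
  mlieBracket_smul_right hg (mdiffAt_of_smooth hW p)

theorem eventually_mdiff {g : M → ℝ} {p : M} (hg : ContMDiffAt (𝓡 3) 𝓘(ℝ, ℝ) ∞ g p) :
    ∀ᶠ q in 𝓝 p, MDifferentiableAt (𝓡 3) 𝓘(ℝ, ℝ) g q := by
  have : IsManifold (𝓡 3) 1 M := inferInstance
  have h1 : ContMDiffAt (𝓡 3) 𝓘(ℝ, ℝ) 1 g p := hg.of_le ENat.LEInfty.out
  filter_upwards [(contMDiffAt_iff_contMDiffAt_nhds (by simp)).1 h1] with q hq using hq.mdifferentiableAt (by simp)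

theorem bracket_bracket_smul {X Y W : RawField M} (hY : SmoothField Y)
    (hW : SmoothField W) {g : M → ℝ} {p : M} (hg : ContMDiffAt (𝓡 3) 𝓘(ℝ, ℝ) ∞ g p) :
    mlieBracket (𝓡 3) X (mlieBracket (𝓡 3) Y (g • W)) p =
      along X (along Y g) p • W p + along Y g p • mlieBracket (𝓡 3) X W p
      + (along X g p • mlieBracket (𝓡 3) Y W p
        + g p • mlieBracket (𝓡 3) X (mlieBracket (𝓡 3) Y W) p) := by
  have : IsManifold (𝓡 3) 2 M := inferInstance
  have : IsManifold (𝓡 3) 1 M := inferInstance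
  have : IsManifold (𝓡 3) (minSmoothness ℝ 2) M := by
    rw [minSmoothness_of_isRCLikeNormedField]; infer_instance
  have e : mlieBracket (𝓡 3) Y (g • W) =ᶠ[𝓝 p]
      (along Y g • W + g • mlieBracket (𝓡 3) Y W : RawField M) := by
    filter_upwards [eventually_mdiff hg] with q hq using bracket_smul hW hq
  have ha := (smooth_along hY hg).mdifferentiableAt (by simp)
  have hb := hg.mdifferentiableAt (by simp)
  have hYW := smooth_bracket hY hW
  rw [EventuallyEq.mlieBracket_vectorField_eq (EventuallyEq.refl _ X) e, mlieBracket_add_right,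
    bracket_smul hW ha, bracket_smul hYW hb]
  · exact ha.smul_section (mdiffAt_of_smooth hW p)
  · exact hb.smul_section (mdiffAt_of_smooth hYW p)

/-- The Lie bracket acts on functions as the commutator of the derivations. -/
theorem along_bracket {X Y : RawField M} (hX : SmoothField X) (hY : SmoothField Y)
    {g : M → ℝ} {p : M} (hg : ContMDiffAt (𝓡 3) 𝓘(ℝ, ℝ) ∞ g p) :
    along (mlieBracket (𝓡 3) X Y) g p = along X (along Y g) p - along Y (along X g) p := by
  have key : ∀ W : RawField M, SmoothField W →
      (along (mlieBracket (𝓡 3) X Y) g p -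
        (along X (along Y g) p - along Y (along X g) p)) • W p = 0 := by
    intro W hW
    have : IsManifold (𝓡 3) (minSmoothness ℝ 3) M :=
      by
      rw [minSmoothness_of_isRCLikeNormedField]; infer_instance
    have two : ∀ {V : RawField M}, SmoothField V →
        ContMDiffAt (𝓡 3) (𝓡 3).tangent (minSmoothness ℝ 2)
          (fun p ↦ (⟨p, V p⟩ : TangentBundle (𝓡 3) M)) p := fun {V} h ↦
      (show ContMDiff _ _ _ _ from h).contMDiffAt.of_le (by simpa using ENat.LEInfty.out)
    have two' : ContMDiffAt (𝓡 3) (𝓡 3).tangent (minSmoothness ℝ 2)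
          (fun p ↦ (⟨p, (g • W) p⟩ : TangentBundle (𝓡 3) M)) p :=
      (hg.of_le (by simpa using ENat.LEInfty.out)).smul_section (two hW)
    have j := leibniz_identity_mlieBracket_apply (two hX) (two hY) two'
    have j' := leibniz_identity_mlieBracket_apply (two hX) (two hY) (two hW)
    rw [bracket_bracket_smul hY hW hg, bracket_bracket_smul hX hW hg,
      bracket_smul hW (hg.mdifferentiableAt (by simp)), j', smul_add] at j
    rw [sub_smul, sub_smul]
    rw [sub_eq_zero]
    rw [← sub_eq_zero] at j
    have j2 : ∀ a b : TangentSpace (𝓡 3) p, b - a = 0 → a = b := fun a b h ↦ (sub_eq_zero.1 h).symm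
    apply j2
    rw [← j]
    abel
  by_cases hXp : X p = 0
  · by_cases hYp : Y p = 0
    · have : mlieBracket (𝓡 3) X Y p = 0 := by
        rw [← mlieBracketWithin_univ]; exact mlieBracketWithin_eq_zero_of_eq_zero hXp hYp
      simp only [along, this, hXp, hYp, map_zero, sub_zero]
    · exact sub_eq_zero.1 ((smul_eq_zero.1 (key Y hY)).resolve_right hYp)
  · exact sub_eq_zero.1 ((smul_eq_zero.1 (key X hX)).resolve_right hXp)

end Calculus

variable (M : Type*) [TopologicalSpace M] [ChartedSpace (EuclideanSpace ℝ (Fin 3)) M]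

/-- The data of a `b^m`-manifold structure on `M`: an order `m ≥ 1`, a hypersurface `Z` (the
critical set) and a function `f` which is smooth near `Z` and defines `Z` there, that is, `Z` is the
zero set of `f` and `df ≠ 0` along `Z`. The values of `f` away from `Z` play no role; a
global defining function is the case in which `f` is smooth on `M` and `Z = f⁻¹(0)`. -/
structure BmStructure where
  /-- the order `m` -/
  m : ℕ
  one_le_m : 1 ≤ m
  /-- the critical set -/
  Z : Set M
  isClosed_Z : IsClosed Z
  /-- the defining function -/
  f : M → ℝ
  smooth_f : ∀ᶠ p in 𝓝ˢ Z, ContMDiffAt (𝓡 3) 𝓘(ℝ, ℝ) ∞ f p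
  zero_iff : ∀ᶠ p in 𝓝ˢ Z, f p = 0 ↔ p ∈ Z
  df_ne_zero : ∀ p ∈ Z, mvfderiv (𝓡 3) f p ≠ 0

namespace BmStructure

variable {M} [IsManifold (𝓡 3) ∞ M] (B : BmStructure M)

/-- The `C^∞(M)`-module of `b^m`-vector fields: smooth vector fields `X` which are tangent to `Z` to
order `m`, that is, `X(f) = f^m g` near `Z` for a smooth function `g`. These are the
sections of the `b^m`-tangent bundle. -/
def VectorFields : Submodule (SmoothFun M) (RawField M) where
  carrier := {X | SmoothField X ∧
    ∃ g : SmoothFun M, ∀ᶠ p in 𝓝ˢ B.Z, along X B.f p = B.f p ^ B.m * g p}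
  zero_mem' := by
    refine ⟨Bundle.contMDiff_zeroSection ℝ (TangentSpace (𝓡 3) : M → Type _), 0, ?_⟩
    exact Eventually.of_forall fun p ↦ by simp [along]
  add_mem' := by
    rintro X Y ⟨hX, g, hg⟩ ⟨hY, h, hh⟩
    refine ⟨ContMDiff.add_section hX hY, g + h, ?_⟩
    filter_upwards [hg, hh] with p hp hp'
    have : along (X + Y) B.f p = along X B.f p + along Y B.f p := by simp [along]
    rw [this, hp, hp', ContMDiffMap.coe_add, Pi.add_apply, mul_add]
  smul_mem' := by
    rintro k X ⟨hX, g, hg⟩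
    refine ⟨ContMDiff.smul_section k.contMDiff hX, k * g, ?_⟩
    filter_upwards [hg] with p hp
    have : along (k • X) B.f p = k p * along X B.f p := by simp [along, smul_eq]
    rw [this, hp, ContMDiffMap.coe_mul, Pi.mul_apply]
    ring

variable {B}

/-- The `b^m`-vector fields form a Lie subalgebra of the Lie algebra of smooth vector fields. -/
theorem bracket_mem (X Y : B.VectorFields) :
    mlieBracket (𝓡 3) (X : RawField M) (Y : RawField M) ∈ B.VectorFields := by
  obtain ⟨hX, g, hg⟩ := X.2
  obtain ⟨hY, h, hh⟩ := Y.2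
  have sm : ∀ {V : RawField M}, SmoothField V → ∀ k : SmoothFun M,
      ContMDiff (𝓡 3) 𝓘(ℝ, ℝ) ∞ (along V k) := fun hV k p ↦
    smooth_along hV k.contMDiff.contMDiffAt
  refine ⟨smooth_bracket hX hY, ⟨fun p ↦ along X h p - along Y g p, (sm hX h).sub (sm hY g)⟩, ?_⟩
  have loc : ∀ {P : M → Prop}, (∀ᶠ p in 𝓝ˢ B.Z, P p) → ∀ᶠ p in 𝓝ˢ B.Z, ∀ᶠ q in 𝓝 p, P q := by
    intro P hP
    obtain ⟨U, hU, hZU, hPU⟩ := eventually_nhdsSet_iff_exists.1 hP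
    exact eventually_nhdsSet_iff_exists.2
      ⟨U, hU, hZU, fun p hp ↦ (hU.eventually_mem hp).mono hPU⟩
  filter_upwards [loc hg, loc hh, B.smooth_f] with p hgp hhp hf
  rw [along_bracket hX hY hf]
  have hd := hf.mdifferentiableAt (by simp)
  have prod : ∀ (V : RawField M) (k : SmoothFun M),
      along V (fun q ↦ B.f q ^ B.m * k q) p =
        B.m * B.f p ^ (B.m - 1) * along V B.f p * k p + B.f p ^ B.m * along V k p := by
    intro V k
    have hk : MDifferentiableAt (𝓡 3) 𝓘(ℝ, ℝ) k p :=
      k.contMDiff.contMDiffAt.mdifferentiableAt (by simp)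
    have h1 : ∀ n : ℕ, MDifferentiableAt (𝓡 3) 𝓘(ℝ, ℝ) (B.f ^ n) p ∧
        along V (B.f ^ n) p = n * B.f p ^ (n - 1) * along V B.f p := by
      intro n
      induction n with
      | zero =>
        have : (B.f ^ 0 : M → ℝ) = fun _ ↦ 1 := by ext; simp
        rw [this, along, mvfderiv_const]
        exact ⟨mdifferentiableAt_const, by simp⟩
      | succ n ih =>
        rw [pow_succ]
        refine ⟨ih.1.mul hd, ?_⟩
        rw [along, mvfderiv_mul ih.1 hd]
        have e := ih.2
        have hpow : (B.f ^ n : M → ℝ) p = B.f p ^ n := rfl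
        simp only [along] at e ⊢
        simp only [add_apply, smul_apply, e, hpow,
          smul_eq_mul]
        rcases n with _ | n
        · simp
        · simp only [Nat.add_sub_cancel, pow_succ]
          push_cast
          ring
    have : (fun q ↦ B.f q ^ B.m * k q) = B.f ^ B.m * (k : M → ℝ) := rfl
    rw [this, along, mvfderiv_mul (h1 B.m).1 hk]
    have h2 := (h1 B.m).2
    simp only [along] at h2 ⊢
    simp [h2]
    ring
  have cong : ∀ (V : RawField M) {a b : M → ℝ}, (∀ᶠ q in 𝓝 p, a q = b q) →
      along V a p = along V b p := by
    intro V a b hab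
    have := Filter.EventuallyEq.mfderiv_eq (I := 𝓡 3) (I' := 𝓘(ℝ, ℝ)) hab
    change mfderiv (𝓡 3) 𝓘(ℝ, ℝ) a p (V p) = mfderiv (𝓡 3) 𝓘(ℝ, ℝ) b p (V p)
    rw [this]
    rfl
  rw [cong X hhp, cong Y hgp, prod, prod, hgp.self_of_nhds, hhp.self_of_nhds]
  change _ = _ * (along X h p - along Y g p)
  ring

/-- The Lie bracket of two `b^m`-vector fields. -/
def bracket (X Y : B.VectorFields) : B.VectorFields :=
  ⟨mlieBracket (𝓡 3) (X : RawField M) (Y : RawField M), bracket_mem X Y⟩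

/-- The derivative of a smooth function along a `b^m`-vector field. -/
def deriv (X : B.VectorFields) (g : SmoothFun M) : SmoothFun M :=
  ⟨along X g, fun _ ↦ smooth_along X.2.1 g.contMDiff.contMDiffAt⟩

variable (B)

/-- `b^m`-forms of degree one: sections of the dual of the `b^m`-tangent bundle, that is, the
`C^∞(M)`-linear dual of the module of `b^m`-vector fields. -/
abbrev OneForms : Type _ := B.VectorFields →ₗ[SmoothFun M] SmoothFun M

variable {B}

/-- The exterior derivative `dα` of a `b^m`-form of degree one, evaluated on `b^m`-vector fields:
`dα(X, Y) = X(α(Y)) - Y(α(X)) - α([X, Y])`. -/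
def extDeriv (α : B.OneForms) (X Y : B.VectorFields) : SmoothFun M :=
  deriv X (α Y) - deriv Y (α X) - α (bracket X Y)

/-- The `b^m`-form `α ∧ dα` of degree three, evaluated on `b^m`-vector fields. -/
def wedgeExtDeriv (α : B.OneForms) (X Y W : B.VectorFields) : SmoothFun M :=
  α X * extDeriv α Y W + α Y * extDeriv α W X + α W * extDeriv α X Y

/-- `α` is a `b^m`-contact form: `α ∧ dα` vanishes at no point, as a section of the third exterior
power of the `b^m`-cotangent bundle. -/
def IsContactForm (α : B.OneForms) : Prop :=
  ∀ p : M, ∃ X Y W : B.VectorFields, wedgeExtDeriv α X Y W p ≠ 0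

/-- `R` is the Reeb vector field of `α`: the `b^m`-vector field with `α(R) = 1` and
`dα(R, ·) = 0`. -/
def IsReebField (α : B.OneForms) (R : B.VectorFields) : Prop :=
  α R = 1 ∧ ∀ Y : B.VectorFields, extDeriv α R Y = 0

end BmStructure

variable {M}

/-- The set `O` is a (nonconstant) periodic orbit of the vector field `X`: the image of a nonconstant
periodic integral curve `ℝ → M`. -/
def IsPeriodicOrbit (X : RawField M) (O : Set M) : Prop :=
  ∃ (γ : ℝ → M) (T : ℝ), IsMIntegralCurve γ X ∧ 0 < T ∧ Function.Periodic γ T ∧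
    (∃ s t : ℝ, γ s ≠ γ t) ∧ O = range γ

end BmContact

end

/-!
The Reeb field `R` is tangent to the critical surface `Z`, and its restriction to `Z` behaves like a
Hamiltonian vector field. The Hamiltonian is `u = α(f^m N)`, where `N` is a vector field with
`N(f) = 1` near `Z`: although `f^m N` vanishes on `Z` as a vector field, it is a nowhere vanishing
section of the `b^m`-tangent bundle there, so that `u` need not vanish. Every `b^m`-vector field is
`g f^m N + V` with `V` tangent to the levels of `f` near `Z`, and `dα(V, f^m N) = V(u)` on `Z`
(`Transverse.extDeriv_E`). Evaluating the Reeb and the contact conditions at a point of `Z` gives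
`R(u) = 0` (`along_reeb_eq_zero`), `u ≠ 0` where `R = 0` (`form_E_ne_zero_of_reeb_eq_zero`), and
`d(u|Z) ≠ 0` where `R ≠ 0` (`exists_along_ne_zero`).

The function `u` vanishes somewhere on `Z` (`exists_form_E_eq_zero`). Otherwise `θ = α / u` is a
one-form on the closed surface `Z`, and `dθ` is `α ∧ dα` contracted with `f^m N` and divided by
`u²`, hence an area form, against Stokes' theorem. No integration theory on `Z` is needed: each
chart of `Z` is given the sign of `α ∧ dα` in it, a partition of unity `ρ` is chosen, and
`∑ ∫ ρ_i dθ = - ∑ ∫ ρ_j dρ_i ∧ θ`, which vanishes because each summand can be computed in either of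
the charts `i` and `j`, and `∑ dρ_i = 0`.

The zeros of `R` on `Z` form a compact set on which `u ≠ 0`, so `R` has no zeros on the levels
`{u = c} ∩ Z` with `c` close to `0`. Near each of its points such a level is a single arc, a
coordinate line of a chart with first coordinates `f` and `u`, traversed by an integral curve of `R`
(`isLocallyOrbit_level`). As the level is compact, its integral curves are defined for all times and
return arbitrarily late to the same arc, so they are periodic (`IsLocallyOrbit.exists_periodic`).
Near a zero of `u` on `Z` the differential of `u|Z` is not zero, so all values close to `0` are
taken (`eventually_level_nonempty`). Different levels contain different orbits, which makes
infinitely many.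
-/

noncomputable section

/-! ### Derivatives along fields and the algebra of `dα` -/

namespace BmContact

section Along

variable {M : Type*} [TopologicalSpace M] [ChartedSpace (EuclideanSpace ℝ (Fin 3)) M]

theorem smoothFun_mdifferentiableAt (g : SmoothFun M) (p : M) :
    MDifferentiableAt (𝓡 3) 𝓘(ℝ, ℝ) g p :=
  g.contMDiff.contMDiffAt.mdifferentiableAt (by simp)

theorem smul_apply_eq (g : SmoothFun M) (X : RawField M) (p : M) : (g • X) p = g p • X p := rfl

theorem mvfderiv_congr_apply {g h : M → ℝ} {p : M} (e : g =ᶠ[𝓝 p] h) (v : TangentSpace (𝓡 3) p) :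
    mvfderiv (𝓡 3) g p v = mvfderiv (𝓡 3) h p v := by
  have := Filter.EventuallyEq.mfderiv_eq (I := 𝓡 3) (I' := 𝓘(ℝ, ℝ)) e
  change mfderiv (𝓡 3) 𝓘(ℝ, ℝ) g p v = mfderiv (𝓡 3) 𝓘(ℝ, ℝ) h p v
  rw [this]
  rfl

theorem along_congr (X : RawField M) {g h : M → ℝ} {p : M} (e : g =ᶠ[𝓝 p] h) :
    along X g p = along X h p :=
  mvfderiv_congr_apply e _

theorem along_congr_field {X Y : RawField M} (g : M → ℝ) {p : M} (e : X p = Y p) :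
    along X g p = along Y g p := by
  simp only [along, e]

theorem along_of_field_eq_zero {X : RawField M} (g : M → ℝ) {p : M} (e : X p = 0) :
    along X g p = 0 := by
  simp only [along, e, map_zero]

theorem along_add_field (X Y : RawField M) (g : M → ℝ) (p : M) :
    along (X + Y) g p = along X g p + along Y g p := by
  simp [along]

theorem along_sub_field (X Y : RawField M) (g : M → ℝ) (p : M) :
    along (X - Y) g p = along X g p - along Y g p := by
  simp [along]

theorem along_smul_field (k : SmoothFun M) (X : RawField M) (g : M → ℝ) (p : M) :
    along (k • X) g p = k p * along X g p := by
  simp [along, smul_eq]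

theorem along_const (X : RawField M) (c : ℝ) (p : M) : along X (fun _ ↦ c) p = 0 := by
  rw [along, mvfderiv_const]; simp

theorem along_mul (X : RawField M) {g h : M → ℝ} {p : M}
    (hg : MDifferentiableAt (𝓡 3) 𝓘(ℝ, ℝ) g p) (hh : MDifferentiableAt (𝓡 3) 𝓘(ℝ, ℝ) h p) :
    along X (fun q ↦ g q * h q) p = along X g p * h p + g p * along X h p := by
  have : (fun q ↦ g q * h q) = g * h := rfl
  rw [this, along, mvfderiv_mul hg hh]
  simp only [along]
  simp
  ring

theorem along_add (X : RawField M) {g h : M → ℝ} {p : M}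
    (hg : MDifferentiableAt (𝓡 3) 𝓘(ℝ, ℝ) g p) (hh : MDifferentiableAt (𝓡 3) 𝓘(ℝ, ℝ) h p) :
    along X (fun q ↦ g q + h q) p = along X g p + along X h p := by
  have : (fun q ↦ g q + h q) = g + h := rfl
  rw [this, along, mvfderiv_add hg hh]
  simp only [along]
  simp

theorem along_pow (X : RawField M) {g : M → ℝ} {p : M}
    (hg : MDifferentiableAt (𝓡 3) 𝓘(ℝ, ℝ) g p) (n : ℕ) :
    along X (fun q ↦ g q ^ n) p = n * g p ^ (n - 1) * along X g p := by
  have key : MDifferentiableAt (𝓡 3) 𝓘(ℝ, ℝ) (fun q ↦ g q ^ n) p ∧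
      along X (fun q ↦ g q ^ n) p = n * g p ^ (n - 1) * along X g p := by
    induction n with
    | zero => simp [along_const, mdifferentiableAt_const]
    | succ n ih =>
      simp only [pow_succ]
      refine ⟨ih.1.mul hg, ?_⟩
      rw [along_mul X ih.1 hg, ih.2]
      rcases n with _ | n
      · simp
      · simp only [Nat.add_sub_cancel, pow_succ]
        push_cast
        ring
  exact key.2

theorem tsupport_along_subset (X : RawField M) (g : M → ℝ) :
    tsupport (along X g) ⊆ tsupport g := by
  refine closure_minimal (fun q hq ↦ ?_) (isClosed_tsupport _)
  by_contra hq'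
  refine hq ?_
  rw [along_congr (h := fun _ ↦ 0) _ (notMem_tsupport_iff_eventuallyEq.1 hq'), along_const]

variable [IsManifold (𝓡 3) ∞ M]

theorem smoothField_smul (g : SmoothFun M) {X : RawField M} (hX : SmoothField X) :
    SmoothField (g • X) :=
  ContMDiff.smul_section g.contMDiff hX

theorem smoothField_sub {X Y : RawField M} (hX : SmoothField X) (hY : SmoothField Y) :
    SmoothField (X - Y) :=
  ContMDiff.sub_section hX hY

end Along

theorem eventually_nhdsSet_eventually_nhds {X : Type*} [TopologicalSpace X] {Z : Set X} {P : X → Prop}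
    (hP : ∀ᶠ p in 𝓝ˢ Z, P p) : ∀ᶠ p in 𝓝ˢ Z, ∀ᶠ q in 𝓝 p, P q := by
  obtain ⟨U, hU, hZU, hPU⟩ := eventually_nhdsSet_iff_exists.1 hP
  exact eventually_nhdsSet_iff_exists.2
    ⟨U, hU, hZU, fun p hp ↦ (hU.eventually_mem hp).mono hPU⟩

namespace BmStructure

variable {M : Type*} [TopologicalSpace M] [ChartedSpace (EuclideanSpace ℝ (Fin 3)) M]
  [IsManifold (𝓡 3) ∞ M] {B : BmStructure M}

theorem extDeriv_apply (α : B.OneForms) (X Y : B.VectorFields) (p : M) :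
    extDeriv α X Y p = along X (α Y) p - along Y (α X) p - α (bracket X Y) p := rfl

theorem bracket_swap (X Y : B.VectorFields) : bracket X Y = - bracket Y X := by
  apply Subtype.ext
  exact mlieBracket_swap

theorem extDeriv_swap (α : B.OneForms) (X Y : B.VectorFields) :
    extDeriv α X Y = - extDeriv α Y X := by
  simp only [extDeriv]
  rw [bracket_swap X Y, map_neg]
  ring

theorem extDeriv_self (α : B.OneForms) (X : B.VectorFields) (p : M) : extDeriv α X X p = 0 := by
  have h := congrArg (fun k : SmoothFun M ↦ k p) (extDeriv_swap α X X)
  have h' : extDeriv α X X p = - extDeriv α X X p := h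
  linarith

theorem bracket_add_right (X Y W : B.VectorFields) :
    bracket X (Y + W) = bracket X Y + bracket X W := by
  apply Subtype.ext
  funext p
  exact mlieBracket_add_right (mdiffAt_of_smooth Y.2.1 p) (mdiffAt_of_smooth W.2.1 p)

theorem bracket_smul_right (X Y : B.VectorFields) (g : SmoothFun M) :
    bracket X (g • Y) = deriv X g • Y + g • bracket X Y := by
  apply Subtype.ext
  funext p
  exact bracket_smul Y.2.1 (smoothFun_mdifferentiableAt g p)

theorem extDeriv_add_right (α : B.OneForms) (X Y W : B.VectorFields) :
    extDeriv α X (Y + W) = extDeriv α X Y + extDeriv α X W := by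
  ext p
  simp only [extDeriv_apply, bracket_add_right, map_add, ContMDiffMap.coe_add, Pi.add_apply]
  have h1 : along (X : RawField M) (α Y + α W : M → ℝ) p =
      along X (α Y) p + along X (α W) p :=
    along_add _ (smoothFun_mdifferentiableAt _ p) (smoothFun_mdifferentiableAt _ p)
  have h2 := along_add_field (Y : RawField M) W (α X) p
  rw [h1, Submodule.coe_add, h2]
  ring

theorem extDeriv_smul_right (α : B.OneForms) (X Y : B.VectorFields) (g : SmoothFun M) :
    extDeriv α X (g • Y) = g * extDeriv α X Y := by
  ext p
  have h1 : along (X : RawField M) (α (g • Y)) p =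
      along X g p * α Y p + g p * along X (α Y) p := by
    rw [map_smul]
    exact along_mul _ (smoothFun_mdifferentiableAt _ p) (smoothFun_mdifferentiableAt _ p)
  have h2 := along_smul_field g (Y : RawField M) (α X) p
  have h3 : α (bracket X (g • Y)) p = along X g p * α Y p + g p * α (bracket X Y) p := by
    rw [bracket_smul_right, map_add, map_smul, map_smul]; rfl
  rw [extDeriv_apply, h1, h3, Submodule.coe_smul, h2, ContMDiffMap.coe_mul, Pi.mul_apply,
    extDeriv_apply]
  ring

theorem extDeriv_add_left (α : B.OneForms) (X Y W : B.VectorFields) :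
    extDeriv α (X + Y) W = extDeriv α X W + extDeriv α Y W := by
  rw [extDeriv_swap, extDeriv_add_right, extDeriv_swap α X, extDeriv_swap α Y]; ring

theorem extDeriv_smul_left (α : B.OneForms) (X Y : B.VectorFields) (g : SmoothFun M) :
    extDeriv α (g • X) Y = g * extDeriv α X Y := by
  rw [extDeriv_swap, extDeriv_smul_right, extDeriv_swap α X]; ring

end BmStructure
end BmContact

/-! ### Cut-off functions and locality of `b^m`-forms -/

namespace BmContact

section CutOff

variable {M : Type*} [TopologicalSpace M] [ChartedSpace (EuclideanSpace ℝ (Fin 3)) M]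
  [IsManifold (𝓡 3) ∞ M] [T2Space M] [SecondCountableTopology M]

theorem exists_cutoff {K U : Set M} (hK : IsClosed K) (hU : U ∈ 𝓝ˢ K) :
    ∃ χ : SmoothFun M, (∀ᶠ q in 𝓝ˢ K, χ q = 1) ∧ tsupport χ ⊆ U := by
  have : LocallyCompactSpace M := ChartedSpace.locallyCompactSpace (EuclideanSpace ℝ (Fin 3)) M
  have : SigmaCompactSpace M := inferInstance
  have hd : Disjoint (interior U)ᶜ K :=
    (disjoint_compl_left_iff_subset).2 (subset_interior_iff_mem_nhdsSet.2 hU)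
  obtain ⟨χ, h0, h1, -⟩ := exists_contMDiffMap_zero_one_nhds_of_isClosed (𝓡 3) (n := ⊤)
    isOpen_interior.isClosed_compl hK hd
  refine ⟨χ, h1, fun q hq ↦ ?_⟩
  by_contra hqU
  have h2 : ∀ᶠ r in 𝓝 q, χ r = 0 :=
    h0.filter_mono (nhds_le_nhdsSet (show q ∈ (interior U)ᶜ from
      fun h ↦ hqU (interior_subset h)))
  exact (notMem_tsupport_iff_eventuallyEq.2 h2) hq

theorem exists_smoothFun_eq_near {K : Set M} (hK : IsClosed K) {h : M → ℝ}
    (hh : ∀ᶠ q in 𝓝ˢ K, ContMDiffAt (𝓡 3) 𝓘(ℝ, ℝ) ∞ h q) :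
    ∃ H : SmoothFun M, ∀ᶠ q in 𝓝ˢ K, H q = h q := by
  obtain ⟨χ, h1, hs⟩ := exists_cutoff hK hh
  have hsm : ContMDiff (𝓡 3) 𝓘(ℝ, ℝ) ∞ (fun q ↦ χ q * h q) := by
    apply contMDiff_of_tsupport
    intro q hq
    have : q ∈ tsupport χ := closure_mono (Function.support_subset_iff'.2 fun r hr ↦ by
      rw [Function.notMem_support.1 hr, zero_mul]) hq
    exact χ.contMDiff.contMDiffAt.mul (hs this)
  exact ⟨⟨_, hsm⟩, h1.mono fun q hq ↦ by change χ q * h q = h q; rw [hq, one_mul]⟩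

theorem exists_smoothField_eq_near {K U : Set M} (hK : IsClosed K) (hU : IsOpen U) (hKU : K ⊆ U)
    {X : RawField M} (hX : ∀ q ∈ U, ContMDiffAt (𝓡 3) (𝓡 3).tangent ∞
      (fun p ↦ (⟨p, X p⟩ : TangentBundle (𝓡 3) M)) q) :
    ∃ Y : RawField M, SmoothField Y ∧ ∀ᶠ q in 𝓝ˢ K, Y q = X q := by
  obtain ⟨χ, h1, hs⟩ := exists_cutoff hK (hU.mem_nhdsSet.2 hKU)
  refine ⟨χ • X, ?_, h1.mono fun q hq ↦ ?_⟩
  · have hX' : ContMDiffOn (𝓡 3) (𝓡 3).tangent ∞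
      (fun p ↦ (⟨p, X p⟩ : TangentBundle (𝓡 3) M)) U := fun q hq ↦ (hX q hq).contMDiffWithinAt
    exact ContMDiffOn.smul_section_of_tsupport χ.contMDiff.contMDiffOn hU hs hX'
  · rw [smul_apply_eq, hq, one_smul]

/-- A smooth function vanishing at `p` may be factored out of a field vanishing near `p`: this is
what makes `C^∞(M)`-linear operations local. -/
theorem exists_smul_eq_self {X : RawField M} {p : M} (hX : ∀ᶠ q in 𝓝 p, X q = 0) :
    ∃ χ : SmoothFun M, χ p = 0 ∧ χ • X = X := by
  obtain ⟨χ, h1, hs⟩ := exists_cutoff (K := {p}) isClosed_singleton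
    (show {q | X q = 0} ∈ 𝓝ˢ {p} by rwa [nhdsSet_singleton])
  refine ⟨1 - χ, ?_, ?_⟩
  · have : χ p = 1 := h1.self_of_nhdsSet p rfl
    simp [this]
  · funext q
    rw [smul_apply_eq]
    by_cases hq : q ∈ tsupport χ
    · have : X q = 0 := hs hq
      rw [this, smul_zero]
    · have : χ q = 0 := image_eq_zero_of_notMem_tsupport hq
      simp [this]

end CutOff

namespace BmStructure

variable {M : Type*} [TopologicalSpace M] [ChartedSpace (EuclideanSpace ℝ (Fin 3)) M]
  [IsManifold (𝓡 3) ∞ M] {B : BmStructure M}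

section Local
variable [T2Space M] [SecondCountableTopology M]

theorem exists_smul_eq_self_vectorFields {X : B.VectorFields} {p : M}
    (hX : ∀ᶠ q in 𝓝 p, (X : RawField M) q = 0) :
    ∃ χ : SmoothFun M, χ p = 0 ∧ χ • X = X := by
  obtain ⟨χ, h0, h⟩ := exists_smul_eq_self hX
  exact ⟨χ, h0, Subtype.ext h⟩

theorem form_apply_eq_zero (α : B.OneForms) {X : B.VectorFields} {p : M}
    (hX : ∀ᶠ q in 𝓝 p, (X : RawField M) q = 0) : α X p = 0 := by
  obtain ⟨χ, h0, h⟩ := exists_smul_eq_self_vectorFields hX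
  rw [← h, map_smul]
  change χ p * α X p = 0
  rw [h0, zero_mul]

theorem extDeriv_apply_eq_zero (α : B.OneForms) {X : B.VectorFields} (Y : B.VectorFields) {p : M}
    (hX : ∀ᶠ q in 𝓝 p, (X : RawField M) q = 0) : extDeriv α X Y p = 0 := by
  obtain ⟨χ, h0, h⟩ := exists_smul_eq_self_vectorFields hX
  rw [← h, extDeriv_smul_left]
  change χ p * extDeriv α X Y p = 0
  rw [h0, zero_mul]

/-- The value of `α(X)` at a point depends only on the field `X` near the point. -/
theorem form_apply_congr (α : B.OneForms) {X Y : B.VectorFields} {p : M}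
    (h : ∀ᶠ q in 𝓝 p, (X : RawField M) q = (Y : RawField M) q) : α X p = α Y p := by
  have h1 : α (X - Y) p = 0 := form_apply_eq_zero α (h.mono fun q hq ↦ by
    simp only [Submodule.coe_sub, Pi.sub_apply, hq, sub_self])
  rw [map_sub, ContMDiffMap.coe_sub, Pi.sub_apply] at h1
  linarith

/-- The value of `dα(X, W)` at a point depends only on the field `X` near the point. -/
theorem extDeriv_apply_congr (α : B.OneForms) {X Y : B.VectorFields} (W : B.VectorFields) {p : M}
    (h : ∀ᶠ q in 𝓝 p, (X : RawField M) q = (Y : RawField M) q) :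
    extDeriv α X W p = extDeriv α Y W p := by
  have h1 : extDeriv α (Y + (X - Y)) W p = extDeriv α Y W p := by
    rw [extDeriv_add_left, ContMDiffMap.coe_add, Pi.add_apply,
      extDeriv_apply_eq_zero (X := X - Y) α W (h.mono fun q hq ↦ by
        simp only [Submodule.coe_sub, Pi.sub_apply, hq, sub_self]), add_zero]
  rwa [add_sub_cancel] at h1

end Local

theorem form_add_apply (α : B.OneForms) (X Y : B.VectorFields) (p : M) :
    α (X + Y) p = α X p + α Y p := by rw [map_add]; rfl

theorem form_smul_apply (α : B.OneForms) (g : SmoothFun M) (X : B.VectorFields) (p : M) :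
    α (g • X) p = g p * α X p := by rw [map_smul]; rfl

theorem extDeriv_add_left_apply (α : B.OneForms) (X Y W : B.VectorFields) (p : M) :
    extDeriv α (X + Y) W p = extDeriv α X W p + extDeriv α Y W p := by
  rw [extDeriv_add_left]; rfl

theorem extDeriv_smul_left_apply (α : B.OneForms) (g : SmoothFun M) (X W : B.VectorFields)
    (p : M) : extDeriv α (g • X) W p = g p * extDeriv α X W p := by
  rw [extDeriv_smul_left]; rfl

theorem extDeriv_swap_apply (α : B.OneForms) (X Y : B.VectorFields) (p : M) :
    extDeriv α X Y p = - extDeriv α Y X p := by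
  rw [extDeriv_swap]; rfl

theorem wedgeExtDeriv_apply (α : B.OneForms) (X Y W : B.VectorFields) (p : M) :
    wedgeExtDeriv α X Y W p =
      α X p * extDeriv α Y W p + α Y p * extDeriv α W X p + α W p * extDeriv α X Y p := rfl

end BmStructure
end BmContact

/-! ### Coordinate frames -/

namespace BmContact

section Coordinates

variable {M : Type*} [TopologicalSpace M] [ChartedSpace (EuclideanSpace ℝ (Fin 3)) M]

/-- Three smooth functions, assembled into a map to `ℝ × ℝ × ℝ`. -/
def coordMap (a : Fin 3 → SmoothFun M) (q : M) : ℝ × ℝ × ℝ := (a 0 q, a 1 q, a 2 q)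

theorem contMDiff_coordMap (a : Fin 3 → SmoothFun M) :
    ContMDiff (𝓡 3) 𝓘(ℝ, ℝ × ℝ × ℝ) ∞ (coordMap a) :=
  (a 0).contMDiff.prodMk_space ((a 1).contMDiff.prodMk_space (a 2).contMDiff)

theorem mvfderiv_clm_comp {F : Type*} [NormedAddCommGroup F] [NormedSpace ℝ F] (L : F →L[ℝ] ℝ)
    {G : M → F} {q : M} (hG : MDifferentiableAt (𝓡 3) 𝓘(ℝ, F) G q) (v : TangentSpace (𝓡 3) q) :
    mvfderiv (𝓡 3) (fun r ↦ L (G r)) q v = L (mvfderiv (𝓡 3) G q v) := by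
  have h := (L.hasMFDerivAt (x := G q)).comp q hG.hasMFDerivAt
  have h2 := h.mfderiv
  change mfderiv (𝓡 3) 𝓘(ℝ, ℝ) (L ∘ G) q v = _
  rw [h2]
  rfl

theorem mvfderiv_coordMap (a : Fin 3 → SmoothFun M) (q : M) (v : TangentSpace (𝓡 3) q) :
    mvfderiv (𝓡 3) (coordMap a) q v =
      (mvfderiv (𝓡 3) (a 0) q v, mvfderiv (𝓡 3) (a 1) q v, mvfderiv (𝓡 3) (a 2) q v) := by
  have hG : MDifferentiableAt (𝓡 3) 𝓘(ℝ, ℝ × ℝ × ℝ) (coordMap a) q :=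
    (contMDiff_coordMap a).contMDiffAt.mdifferentiableAt (by simp)
  have h0 := mvfderiv_clm_comp (ContinuousLinearMap.fst ℝ ℝ (ℝ × ℝ)) hG v
  have h1 := mvfderiv_clm_comp
    ((ContinuousLinearMap.fst ℝ ℝ ℝ).comp (ContinuousLinearMap.snd ℝ ℝ (ℝ × ℝ))) hG v
  have h2 := mvfderiv_clm_comp
    ((ContinuousLinearMap.snd ℝ ℝ ℝ).comp (ContinuousLinearMap.snd ℝ ℝ (ℝ × ℝ))) hG v
  refine Prod.ext h0.symm (Prod.ext h1.symm h2.symm)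

/-- Three smooth functions whose differentials at `p` have no common zero are, by the inverse
function theorem, the coordinates of a smooth chart at `p`. -/
theorem exists_coordChart [IsManifold (𝓡 3) ∞ M] (a : Fin 3 → SmoothFun M) (p : M)
    (h : ∀ v : TangentSpace (𝓡 3) p, (∀ j, mvfderiv (𝓡 3) (a j) p v = 0) → v = 0) :
    ∃ ψ : OpenPartialHomeomorph M (ℝ × ℝ × ℝ), p ∈ ψ.source ∧ (∀ q ∈ ψ.source, ψ q = coordMap a q) ∧
      ContMDiffOn 𝓘(ℝ, ℝ × ℝ × ℝ) (𝓡 3) ∞ ψ.symm ψ.target := by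
  set e := chartAt (EuclideanSpace ℝ (Fin 3)) p with he
  have : IsManifold (𝓡 3) 1 M := inferInstance
  have hpe : p ∈ e.source := mem_chart_source _ p
  have hep : e p ∈ e.target := e.map_source hpe
  let g : EuclideanSpace ℝ (Fin 3) → ℝ × ℝ × ℝ := coordMap a ∘ e.symm
  have hsymm : ContMDiffOn (𝓡 3) (𝓡 3) ∞ e.symm e.target := contMDiffOn_chart_symm
  have hg : ∀ x ∈ e.target, ContDiffAt ℝ ∞ g x := fun x hx ↦
    ((contMDiff_coordMap a).contMDiffAt.comp x
      (hsymm.contMDiffAt (e.open_target.mem_nhds hx))).contDiffAt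
  have hgOn : ContDiffOn ℝ ∞ g e.target := fun x hx ↦ (hg x hx).contDiffWithinAt
  -- the derivative of `g` at the point `e p` is injective, hence invertible
  have hinj : Function.Injective (fderiv ℝ g (e p)) := by
    rw [injective_iff_map_eq_zero]
    intro w hw
    have hes : MDifferentiableAt (𝓡 3) (𝓡 3) e.symm (e p) :=
      (hsymm.contMDiffAt (e.open_target.mem_nhds hep)).mdifferentiableAt (by simp)
    have hee : MDifferentiableAt (𝓡 3) (𝓡 3) e p :=
      ((contMDiffOn_chart (I := 𝓡 3) (n := ∞) (x := p)).contMDiffAt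
        (e.open_source.mem_nhds hpe)).mdifferentiableAt (by simp)
    have hG : MDifferentiableAt (𝓡 3) 𝓘(ℝ, ℝ × ℝ × ℝ) (coordMap a) (e.symm (e p)) :=
      (contMDiff_coordMap a).contMDiffAt.mdifferentiableAt (by simp)
    have hcomp := mfderiv_comp_apply (e p) hG hes w
    have hg0 : mfderiv (𝓡 3) 𝓘(ℝ, ℝ × ℝ × ℝ) g (e p) w = 0 := by
      rw [mfderiv_eq_fderiv]; exact hw
    have h0 : mfderiv (𝓡 3) (𝓡 3) e.symm (e p) w = 0 := by
      have key : ∀ r, r = p → ∀ v : TangentSpace (𝓡 3) r,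
          mvfderiv (𝓡 3) (coordMap a) r v = 0 → v = 0 := by
        rintro r rfl v hv
        rw [mvfderiv_coordMap] at hv
        refine h v fun j ↦ ?_
        fin_cases j
        · exact congrArg Prod.fst hv
        · exact congrArg (fun z ↦ z.2.1) hv
        · exact congrArg (fun z ↦ z.2.2) hv
      exact key _ (e.left_inv hpe) _ (hcomp.symm.trans hg0)
    have hid : (e ∘ e.symm) =ᶠ[𝓝 (e p)] id :=
      Filter.eventually_of_mem (e.open_target.mem_nhds hep) fun x hx ↦ e.right_inv hx
    have hee' : MDifferentiableAt (𝓡 3) (𝓡 3) e (e.symm (e p)) := by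
      rw [e.left_inv hpe]; exact hee
    have hc := mfderiv_comp_apply (e p) hee' hes w
    rw [hid.mfderiv_eq, mfderiv_id, h0, map_zero] at hc
    exact hc
  have hfr : Module.finrank ℝ (EuclideanSpace ℝ (Fin 3)) = Module.finrank ℝ (ℝ × ℝ × ℝ) := by simp
  let f' : EuclideanSpace ℝ (Fin 3) ≃L[ℝ] ℝ × ℝ × ℝ :=
    (LinearEquiv.ofInjectiveOfFinrankEq (fderiv ℝ g (e p)).toLinearMap hinj
      hfr).toContinuousLinearEquiv
  have hf' : (f' : EuclideanSpace ℝ (Fin 3) →L[ℝ] ℝ × ℝ × ℝ) = fderiv ℝ g (e p) := by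
    ext1 x; rfl
  have hgp := hg _ hep
  have hder : HasFDerivAt g (f' : EuclideanSpace ℝ (Fin 3) →L[ℝ] ℝ × ℝ × ℝ) (e p) := by
    rw [hf']; exact (hgp.differentiableAt (by simp)).hasFDerivAt
  let θ := hgp.toOpenPartialHomeomorph g hder (by simp)
  have hθ : ⇑θ = g := hgp.toOpenPartialHomeomorph_coe hder (by simp)
  let U : Set (EuclideanSpace ℝ (Fin 3)) := e.target ∩
    (fderiv ℝ g) ⁻¹' (range ContinuousLinearEquiv.toContinuousLinearMap)
  have hU : IsOpen U := (hgOn.continuousOn_fderiv_of_isOpen e.open_target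
    (by simp)).isOpen_inter_preimage e.open_target ContinuousLinearEquiv.isOpen
  have hpU : e p ∈ U := ⟨hep, f', hf'⟩
  let θ' := θ.restrOpen U hU
  have hsrc : θ'.source = θ.source ∩ U := θ.restrOpen_source U hU
  have hθ' : ⇑θ' = g := hθ
  refine ⟨e.trans θ', ?_, ?_, ?_⟩
  · rw [OpenPartialHomeomorph.trans_source]
    refine ⟨hpe, ?_⟩
    rw [mem_preimage, hsrc]
    exact ⟨hgp.mem_toOpenPartialHomeomorph_source hder (by simp), hpU⟩
  · intro q hq
    rw [OpenPartialHomeomorph.trans_source] at hq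
    rw [OpenPartialHomeomorph.trans_apply, hθ']
    exact congrArg (coordMap a) (e.left_inv hq.1)
  · intro y hy
    rw [OpenPartialHomeomorph.trans_target] at hy
    have hx := θ'.map_target hy.1
    rw [hsrc] at hx
    obtain ⟨f'', hf''⟩ := hx.2.2
    have hc : ContDiffAt ℝ ∞ θ'.symm y := by
      refine θ'.contDiffAt_symm hy.1 (f₀' := f'') ?_ ?_
      · rw [hθ', hf'']
        exact ((hg _ hx.2.1).differentiableAt (by simp)).hasFDerivAt
      · rw [hθ']; exact hg _ hx.2.1
    exact ((hsymm.contMDiffAt (e.open_target.mem_nhds hx.2.1)).comp y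
      hc.contMDiffAt).contMDiffWithinAt

variable (M) in
/-- A smooth chart of `M` with values in `ℝ × ℝ × ℝ` whose coordinates extend to smooth functions
on `M` and whose coordinate vector fields extend to smooth vector fields on `M`. -/
structure Frame [IsManifold (𝓡 3) ∞ M] where
  /-- the chart -/
  chart : OpenPartialHomeomorph M (ℝ × ℝ × ℝ)
  /-- the coordinates, as functions on `M` -/
  coord : Fin 3 → SmoothFun M
  /-- the coordinate vector fields, extended to `M` -/
  field : Fin 3 → RawField M
  chart_eq : ∀ q ∈ chart.source, chart q = coordMap coord q
  contMDiffOn_symm : ContMDiffOn 𝓘(ℝ, ℝ × ℝ × ℝ) (𝓡 3) ∞ chart.symm chart.target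
  smooth_field : ∀ i, SmoothField (field i)
  along_field : ∀ i j, ∀ q ∈ chart.source, along (field i) (coord j) q = if i = j then 1 else 0
  eq_zero : ∀ q ∈ chart.source, ∀ v : TangentSpace (𝓡 3) q,
    (∀ j, mvfderiv (𝓡 3) (coord j) q v = 0) → v = 0

theorem isInvertible_mfderiv_coordMap (a : Fin 3 → SmoothFun M)
    {ψ : OpenPartialHomeomorph M (ℝ × ℝ × ℝ)}
    (hψ : ∀ q ∈ ψ.source, ψ q = coordMap a q)
    (hs : ContMDiffOn 𝓘(ℝ, ℝ × ℝ × ℝ) (𝓡 3) ∞ ψ.symm ψ.target) {q : M} (hq : q ∈ ψ.source) :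
    (mfderiv (𝓡 3) 𝓘(ℝ, ℝ × ℝ × ℝ) (coordMap a) q).IsInvertible := by
  have hG : MDifferentiableAt (𝓡 3) 𝓘(ℝ, ℝ × ℝ × ℝ) (coordMap a) q :=
    (contMDiff_coordMap a).contMDiffAt.mdifferentiableAt (by simp)
  have hqt : coordMap a q ∈ ψ.target := by rw [← hψ q hq]; exact ψ.map_source hq
  have hsymm : MDifferentiableAt 𝓘(ℝ, ℝ × ℝ × ℝ) (𝓡 3) ψ.symm (coordMap a q) :=
    (hs.contMDiffAt (ψ.open_target.mem_nhds hqt)).mdifferentiableAt (by simp)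
  have hback : ψ.symm (coordMap a q) = q := by rw [← hψ q hq]; exact ψ.left_inv hq
  have hG' : MDifferentiableAt (𝓡 3) 𝓘(ℝ, ℝ × ℝ × ℝ) (coordMap a) (ψ.symm (coordMap a q)) := by
    rwa [hback]
  have e1 : (ψ.symm ∘ coordMap a) =ᶠ[𝓝 q] id := by
    filter_upwards [ψ.open_source.mem_nhds hq] with r hr
    rw [Function.comp_apply, ← hψ r hr]; exact ψ.left_inv hr
  have e2 : (coordMap a ∘ ψ.symm) =ᶠ[𝓝 (coordMap a q)] id := by
    filter_upwards [ψ.open_target.mem_nhds hqt] with r hr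
    rw [Function.comp_apply, ← hψ _ (ψ.map_target hr)]; exact ψ.right_inv hr
  have c1 := mfderiv_comp q hsymm hG
  rw [e1.mfderiv_eq, mfderiv_id] at c1
  have c2 := mfderiv_comp (coordMap a q) hG' hsymm
  rw [e2.mfderiv_eq, mfderiv_id] at c2
  have hinj : Function.Injective (mfderiv (𝓡 3) 𝓘(ℝ, ℝ × ℝ × ℝ) (coordMap a) q) := by
    intro v w hvw
    have h1 := congrArg (fun L ↦ L v) c1
    have h2 := congrArg (fun L ↦ L w) c1
    have h3 := congrArg (mfderiv 𝓘(ℝ, ℝ × ℝ × ℝ) (𝓡 3) ψ.symm (coordMap a q)) hvw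
    exact h1.trans (h3.trans h2.symm)
  have hfr : Module.finrank ℝ (EuclideanSpace ℝ (Fin 3)) = Module.finrank ℝ (ℝ × ℝ × ℝ) := by simp
  let D : EuclideanSpace ℝ (Fin 3) →L[ℝ] ℝ × ℝ × ℝ := mfderiv (𝓡 3) 𝓘(ℝ, ℝ × ℝ × ℝ) (coordMap a) q
  let f' : EuclideanSpace ℝ (Fin 3) ≃L[ℝ] ℝ × ℝ × ℝ :=
    (LinearEquiv.ofInjectiveOfFinrankEq D.toLinearMap hinj hfr).toContinuousLinearEquiv
  exact ⟨f', by ext1 v; rfl⟩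

variable [IsManifold (𝓡 3) ∞ M]

/-- The coordinate vector fields are the pullbacks of the constant fields on `ℝ × ℝ × ℝ`. To
extend them to `M` they are cut off, so the chart has to be shrunk around `p`. -/
theorem exists_frame_of_chart (a : Fin 3 → SmoothFun M) {ψ : OpenPartialHomeomorph M (ℝ × ℝ × ℝ)}
    (hψ : ∀ q ∈ ψ.source, ψ q = coordMap a q)
    (hs : ContMDiffOn 𝓘(ℝ, ℝ × ℝ × ℝ) (𝓡 3) ∞ ψ.symm ψ.target) [T2Space M]
    [SecondCountableTopology M] {p : M} (hp : p ∈ ψ.source) :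
    ∃ Φ : Frame M, Φ.coord = a ∧ p ∈ Φ.chart.source := by
  have : IsManifold (𝓡 3) 1 M := inferInstance
  let w : Fin 3 → ℝ × ℝ × ℝ := ![(1, 0, 0), (0, 1, 0), (0, 0, 1)]
  let X : Fin 3 → RawField M := fun i ↦
    mpullback (𝓡 3) 𝓘(ℝ, ℝ × ℝ × ℝ) (coordMap a) (fun _ ↦ w i)
  have hXs : ∀ i, ∀ q ∈ ψ.source, ContMDiffAt (𝓡 3) (𝓡 3).tangent ∞
      (fun p ↦ (⟨p, X i p⟩ : TangentBundle (𝓡 3) M)) q := by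
    intro i q hq
    have hV : ContMDiffAt 𝓘(ℝ, ℝ × ℝ × ℝ) 𝓘(ℝ, ℝ × ℝ × ℝ).tangent ∞
        (fun x ↦ (⟨x, w i⟩ : TangentBundle 𝓘(ℝ, ℝ × ℝ × ℝ) (ℝ × ℝ × ℝ))) (coordMap a q) := by
      exact contMDiffAt_vectorSpace_iff_contDiffAt (V := fun _ ↦ w i).2 contDiffAt_const
    exact ContMDiffAt.mpullback_vectorField_preimage hV (contMDiff_coordMap a).contMDiffAt
      (isInvertible_mfderiv_coordMap a hψ hs hq) (by simp)
  have hXd : ∀ i, ∀ q ∈ ψ.source, mvfderiv (𝓡 3) (coordMap a) q (X i q) = w i := by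
    intro i q hq
    exact (isInvertible_mfderiv_coordMap a hψ hs hq).self_apply_inverse (w i)
  choose Y hY hYX using fun i ↦ exists_smoothField_eq_near (K := {p}) isClosed_singleton
    ψ.open_source (singleton_subset_iff.2 hp) (hXs i)
  simp only [nhdsSet_singleton] at hYX
  obtain ⟨U, hUY, hU, hpU⟩ := eventually_nhds_iff.1 (eventually_all.2 hYX)
  have hsrc : (ψ.restrOpen U hU).source = ψ.source ∩ U := ψ.restrOpen_source U hU
  refine ⟨⟨ψ.restrOpen U hU, a, Y, fun q hq ↦ hψ q (hsrc ▸ hq).1, ?_, hY, ?_, ?_⟩, rfl, ?_⟩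
  · refine hs.mono fun y hy ↦ ?_
    exact hy.1
  · intro i j q hq
    rw [hsrc] at hq
    have h1 := hXd i q hq.1
    rw [← hUY q hq.2 i, mvfderiv_coordMap] at h1
    rw [along]
    fin_cases j
    · have h2 := congrArg Prod.fst h1
      refine h2.trans ?_
      fin_cases i <;> simp [w]
    · have h2 := congrArg (fun z ↦ z.2.1) h1
      refine h2.trans ?_
      fin_cases i <;> simp [w]
    · have h2 := congrArg (fun z ↦ z.2.2) h1
      refine h2.trans ?_
      fin_cases i <;> simp [w]
  · intro q hq v hv
    rw [hsrc] at hq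
    have hi := isInvertible_mfderiv_coordMap a hψ hs hq.1
    have h0 : mfderiv (𝓡 3) 𝓘(ℝ, ℝ × ℝ × ℝ) (coordMap a) q v = 0 := by
      have := mvfderiv_coordMap a q v
      rw [hv 0, hv 1, hv 2] at this
      exact this
    have h1 := hi.inverse_apply_self v
    rw [h0, map_zero] at h1
    exact h1.symm
  · change p ∈ (ψ.restrOpen U hU).source
    rw [hsrc]; exact ⟨hp, hpU⟩

theorem exists_frame [T2Space M] [SecondCountableTopology M] (a : Fin 3 → SmoothFun M) (p : M)
    (h : ∀ v : TangentSpace (𝓡 3) p, (∀ j, mvfderiv (𝓡 3) (a j) p v = 0) → v = 0) :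
    ∃ Φ : Frame M, Φ.coord = a ∧ p ∈ Φ.chart.source := by
  obtain ⟨ψ, hp, hψ, hs⟩ := exists_coordChart a p h
  exact exists_frame_of_chart a hψ hs hp

/-- Every linear functional on a tangent space is the differential of a smooth function. -/
theorem exists_smoothFun_mvfderiv_eq [T2Space M] [SecondCountableTopology M] (p : M)
    (ℓ : EuclideanSpace ℝ (Fin 3) →L[ℝ] ℝ) :
    ∃ h : SmoothFun M, ∀ v : TangentSpace (𝓡 3) p, mvfderiv (𝓡 3) h p v = ℓ v := by
  have : IsManifold (𝓡 3) 1 M := inferInstance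
  have hsm : ∀ q ∈ (extChartAt (𝓡 3) p).source,
      ContMDiffAt (𝓡 3) 𝓘(ℝ, EuclideanSpace ℝ (Fin 3)) ∞ (extChartAt (𝓡 3) p) q := fun q hq ↦
    (contMDiffOn_extChartAt (I := 𝓡 3) (n := ∞) (x := p)).contMDiffAt
      ((chartAt (EuclideanSpace ℝ (Fin 3)) p).open_source.mem_nhds (by simpa using hq))
  have hh : ∀ᶠ q in 𝓝ˢ {p}, ContMDiffAt (𝓡 3) 𝓘(ℝ, ℝ) ∞ (fun q ↦ ℓ (extChartAt (𝓡 3) p q)) q := by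
    rw [nhdsSet_singleton]
    filter_upwards [extChartAt_source_mem_nhds (I := 𝓡 3) p] with q hq
    exact ℓ.contMDiff.contMDiffAt.comp q (hsm q hq)
  obtain ⟨H, hH⟩ := exists_smoothFun_eq_near isClosed_singleton hh
  rw [nhdsSet_singleton] at hH
  refine ⟨H, fun v ↦ ?_⟩
  have h1 : mvfderiv (𝓡 3) H p v = mvfderiv (𝓡 3) (fun q ↦ ℓ (extChartAt (𝓡 3) p q)) p v :=
    mvfderiv_congr_apply hH v
  rw [h1, mvfderiv_clm_comp ℓ ((hsm p (mem_extChartAt_source p)).mdifferentiableAt (by simp))]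
  change ℓ (mfderiv (𝓡 3) 𝓘(ℝ, EuclideanSpace ℝ (Fin 3)) (extChartAt (𝓡 3) p) p v) = ℓ v
  rw [mfderiv_extChartAt_self]
  rfl

/-- A suitable linear functional lowers the dimension of a given subspace by one. -/
theorem exists_finrank_inf_ker_le {E : Type*} [NormedAddCommGroup E] [NormedSpace ℝ E]
    [FiniteDimensional ℝ E] (K : Submodule ℝ E) {k : ℕ} (hK : Module.finrank ℝ K ≤ k + 1) :
    ∃ ℓ : E →L[ℝ] ℝ, Module.finrank ℝ (K ⊓ ℓ.ker : Submodule ℝ E) ≤ k := by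
  by_cases h : K = ⊥
  · subst h
    exact ⟨0, by rw [bot_inf_eq, finrank_bot]; exact Nat.zero_le _⟩
  · obtain ⟨v, hv, hv0⟩ := K.exists_mem_ne_zero_of_ne_bot h
    obtain ⟨ℓ, hℓ⟩ := SeparatingDual.exists_ne_zero (R := ℝ) hv0
    refine ⟨ℓ, Nat.lt_succ_iff.1 (lt_of_lt_of_le (Submodule.finrank_lt_finrank_of_lt ?_) hK)⟩
    refine lt_of_le_of_ne inf_le_left fun e ↦ hℓ ?_
    have : v ∈ K ⊓ ℓ.ker := by rw [e]; exact hv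
    exact this.2

theorem finrank_ker_lt_three {ℓ : EuclideanSpace ℝ (Fin 3) →L[ℝ] ℝ} (h : ℓ ≠ 0) :
    Module.finrank ℝ (ℓ.ker : Submodule ℝ (EuclideanSpace ℝ (Fin 3))) < 3 := by
  have h3 : Module.finrank ℝ (EuclideanSpace ℝ (Fin 3)) = 3 := by simp
  refine lt_of_lt_of_eq (Submodule.finrank_lt fun e ↦ h ?_) h3
  ext1 v
  have : v ∈ ℓ.ker := by rw [e]; exact Submodule.mem_top
  exact this

/-- One smooth function with nonzero differential at `p` is the first coordinate of a chart. -/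
theorem exists_frame_of_one [T2Space M] [SecondCountableTopology M] (a : SmoothFun M) (p : M)
    (ha : mvfderiv (𝓡 3) a p ≠ 0) :
    ∃ Φ : Frame M, Φ.coord 0 = a ∧ p ∈ Φ.chart.source := by
  let ℓ0 : EuclideanSpace ℝ (Fin 3) →L[ℝ] ℝ := mvfderiv (𝓡 3) a p
  have h0 : Module.finrank ℝ (ℓ0.ker : Submodule ℝ _) ≤ 2 :=
    Nat.lt_succ_iff.1 (finrank_ker_lt_three ha)
  obtain ⟨ℓ1, h1⟩ := exists_finrank_inf_ker_le _ h0
  obtain ⟨ℓ2, h2⟩ := exists_finrank_inf_ker_le _ h1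
  obtain ⟨b, hb⟩ := exists_smoothFun_mvfderiv_eq p ℓ1
  obtain ⟨c, hc⟩ := exists_smoothFun_mvfderiv_eq p ℓ2
  obtain ⟨Φ, h, hp⟩ := exists_frame ![a, b, c] p fun v hv ↦ by
    have e := Submodule.finrank_eq_zero.1 (Nat.le_zero.1 h2)
    refine (Submodule.mem_bot ℝ).1 (e ▸ ⟨⟨hv 0, (hb v).symm.trans (hv 1)⟩, (hc v).symm.trans (hv 2)⟩)
  exact ⟨Φ, by rw [h]; rfl, hp⟩

/-- Two smooth functions with independent differentials at `p` are the first two coordinates of a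
chart. The independence is stated by means of a field annihilating the first function. -/
theorem exists_frame_of_two [T2Space M] [SecondCountableTopology M] (a b : SmoothFun M) (p : M)
    (ha : mvfderiv (𝓡 3) a p ≠ 0) {W : RawField M} (hWa : along W a p = 0) (hWb : along W b p ≠ 0) :
    ∃ Φ : Frame M, Φ.coord 0 = a ∧ Φ.coord 1 = b ∧ p ∈ Φ.chart.source := by
  let ℓ0 : EuclideanSpace ℝ (Fin 3) →L[ℝ] ℝ := mvfderiv (𝓡 3) a p
  let ℓ1 : EuclideanSpace ℝ (Fin 3) →L[ℝ] ℝ := mvfderiv (𝓡 3) b p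
  have h0 : Module.finrank ℝ (ℓ0.ker : Submodule ℝ _) < 3 := finrank_ker_lt_three ha
  have h1 : Module.finrank ℝ (ℓ0.ker ⊓ ℓ1.ker : Submodule ℝ _) <
      Module.finrank ℝ (ℓ0.ker : Submodule ℝ _) := by
    refine Submodule.finrank_lt_finrank_of_lt (lt_of_le_of_ne inf_le_left fun e ↦ hWb ?_)
    have : (W p : EuclideanSpace ℝ (Fin 3)) ∈ ℓ0.ker ⊓ ℓ1.ker := by rw [e]; exact hWa
    exact this.2
  obtain ⟨ℓ2, h2⟩ := exists_finrank_inf_ker_le (ℓ0.ker ⊓ ℓ1.ker) (k := 0) (by omega)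
  obtain ⟨c, hc⟩ := exists_smoothFun_mvfderiv_eq p ℓ2
  obtain ⟨Φ, h, hp⟩ := exists_frame ![a, b, c] p fun v hv ↦ by
    have e := Submodule.finrank_eq_zero.1 (Nat.le_zero.1 h2)
    refine (Submodule.mem_bot ℝ).1 (e ▸ ⟨⟨hv 0, hv 1⟩, (hc v).symm.trans (hv 2)⟩)
  exact ⟨Φ, by rw [h]; rfl, by rw [h]; rfl, hp⟩

end Coordinates
end BmContact

/-! ### The field `f^m N` and pointwise consequences of the contact condition -/

namespace BmContact

variable {M : Type*} [TopologicalSpace M] [ChartedSpace (EuclideanSpace ℝ (Fin 3)) M]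

namespace BmStructure

variable {B : BmStructure M}

theorem along_f_eq {F : SmoothFun M} (hF : ∀ᶠ q in 𝓝ˢ B.Z, F q = B.f q) (X : RawField M) :
    ∀ᶠ q in 𝓝ˢ B.Z, along X F q = along X B.f q :=
  (eventually_nhdsSet_eventually_nhds hF).mono fun _ hq ↦ along_congr X hq

theorem mvfderiv_ne_zero {F : SmoothFun M} (hF : ∀ᶠ q in 𝓝ˢ B.Z, F q = B.f q) {p : M}
    (hp : p ∈ B.Z) : mvfderiv (𝓡 3) F p ≠ 0 := by
  intro h
  refine B.df_ne_zero p hp ?_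
  ext1 v
  rw [← mvfderiv_congr_apply ((eventually_nhdsSet_eventually_nhds hF).self_of_nhdsSet p hp) v, h]

end BmStructure

variable [IsManifold (𝓡 3) ∞ M]

namespace Frame

/-- The restriction of a frame to an open set. -/
def restr (Φ : Frame M) (U : Set M) (hU : IsOpen U) : Frame M where
  chart := Φ.chart.restrOpen U hU
  coord := Φ.coord
  field := Φ.field
  chart_eq q hq := Φ.chart_eq q hq.1
  contMDiffOn_symm := Φ.contMDiffOn_symm.mono fun _ hy ↦ hy.1
  smooth_field := Φ.smooth_field
  along_field i j q hq := Φ.along_field i j q hq.1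
  eq_zero q hq := Φ.eq_zero q hq.1

theorem field_expansion (Φ : Frame M) (V : RawField M) {q : M} (hq : q ∈ Φ.chart.source) :
    V q = along V (Φ.coord 0) q • Φ.field 0 q + along V (Φ.coord 1) q • Φ.field 1 q
      + along V (Φ.coord 2) q • Φ.field 2 q := by
  have h := Φ.eq_zero q hq (V q - (along V (Φ.coord 0) q • Φ.field 0 q +
    along V (Φ.coord 1) q • Φ.field 1 q + along V (Φ.coord 2) q • Φ.field 2 q)) fun j ↦ by
      have e : ∀ i, mvfderiv (𝓡 3) (Φ.coord j) q (Φ.field i q) = if i = j then 1 else 0 :=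
        fun i ↦ Φ.along_field i j q hq
      rw [map_sub, map_add, map_add, map_smul, map_smul, map_smul, e, e, e]
      fin_cases j <;> simp [along]
  exact sub_eq_zero.1 h

theorem mlieBracket_field (Φ : Frame M) (i j : Fin 3) {q : M} (hq : q ∈ Φ.chart.source) :
    mlieBracket (𝓡 3) (Φ.field i) (Φ.field j) q = 0 := by
  refine Φ.eq_zero q hq _ fun k ↦ ?_
  have h := along_bracket (Φ.smooth_field i) (Φ.smooth_field j)
    ((Φ.coord k).contMDiff.contMDiffAt (x := q))
  have hc : ∀ i' j', along (Φ.field i') (along (Φ.field j') (Φ.coord k)) q = 0 := by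
    intro i' j'
    rw [along_congr (h := fun _ ↦ if j' = k then 1 else 0), along_const]
    filter_upwards [Φ.chart.open_source.mem_nhds hq] with r hr using Φ.along_field j' k r hr
  rw [hc, hc, sub_zero] at h
  exact h

end Frame

namespace BmStructure

variable {B : BmStructure M}

variable (B) in
/-- A smooth function agreeing with the defining function near `Z`, together with a smooth vector
field along which it grows at unit speed near `Z`. -/
structure Transverse where
  /-- the function, equal to `f` near `Z` -/
  F : SmoothFun M
  F_eq : ∀ᶠ q in 𝓝ˢ B.Z, F q = B.f q
  /-- the field transverse to `Z` -/
  N : RawField M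
  smooth_N : SmoothField N
  along_N : ∀ᶠ q in 𝓝ˢ B.Z, along N F q = 1

/-- The condition `dF(N) = 1` on `N` is convex and solved locally by a coordinate field, so local
solutions can be glued with a partition of unity. -/
theorem exists_transverse [T2Space M] [SecondCountableTopology M] (B : BmStructure M) :
    Nonempty B.Transverse := by
  have : LocallyCompactSpace M := ChartedSpace.locallyCompactSpace (EuclideanSpace ℝ (Fin 3)) M
  have : SigmaCompactSpace M := inferInstance
  obtain ⟨F, hF⟩ := exists_smoothFun_eq_near B.isClosed_Z B.smooth_f
  choose Φ hΦ hpΦ using fun p : B.Z ↦ exists_frame_of_one F p.1 (mvfderiv_ne_zero hF p.2)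
  have hU : (⋃ p : B.Z, (Φ p).chart.source) ∈ 𝓝ˢ B.Z :=
    (isOpen_iUnion fun p ↦ (Φ p).chart.open_source).mem_nhdsSet.2
      fun p hp ↦ mem_iUnion.2 ⟨⟨p, hp⟩, hpΦ ⟨p, hp⟩⟩
  obtain ⟨χ, h1, hs⟩ := exists_cutoff B.isClosed_Z hU
  obtain ⟨N, hN⟩ := exists_contMDiffSection_forall_mem_convex_of_local (n := ⊤) (𝓡 3)
    (F_fiber := EuclideanSpace ℝ (Fin 3)) (TangentSpace (𝓡 3) : M → Type _)
    (fun q ↦ {v | q ∈ tsupport χ → mvfderiv (𝓡 3) F q v = 1}) (by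
      intro q v hv w hw s t _ _ hst hq
      rw [map_add, map_smul, map_smul, hv hq, hw hq, smul_eq_mul, smul_eq_mul, mul_one, mul_one,
        hst]) (by
      intro q
      by_cases hq : q ∈ tsupport χ
      · obtain ⟨p, hp⟩ := mem_iUnion.1 (hs hq)
        refine ⟨(Φ p).chart.source, (Φ p).chart.open_source.mem_nhds hp, (Φ p).field 0,
          ContMDiff.contMDiffOn ((Φ p).smooth_field 0), fun r hr _ ↦ ?_⟩
        have := (Φ p).along_field 0 0 r hr
        rw [hΦ p] at this
        exact this.trans (if_pos rfl)
      · refine ⟨(tsupport χ)ᶜ, (isClosed_tsupport χ).isOpen_compl.mem_nhds hq, 0, ?_,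
          fun r hr h ↦ absurd h hr⟩
        exact (Bundle.contMDiff_zeroSection ℝ (TangentSpace (𝓡 3) : M → Type _)).contMDiffOn)
  refine ⟨⟨F, hF, N, N.contMDiff, h1.mono fun q hq ↦ hN q (subset_closure ?_)⟩⟩
  rw [Function.mem_support, hq]
  exact one_ne_zero

namespace Transverse

variable (D : B.Transverse)

theorem F_eq_zero_iff : ∀ᶠ q in 𝓝ˢ B.Z, D.F q = 0 ↔ q ∈ B.Z := by
  filter_upwards [D.F_eq, B.zero_iff] with q h1 h2
  rw [h1, h2]

theorem F_eq_zero {p : M} (hp : p ∈ B.Z) : D.F p = 0 :=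
  (D.F_eq_zero_iff.self_of_nhdsSet p hp).2 hp

theorem mem_vectorFields_iff {X : RawField M} : X ∈ B.VectorFields ↔
    SmoothField X ∧ ∃ g : SmoothFun M, ∀ᶠ q in 𝓝ˢ B.Z, along X D.F q = D.F q ^ B.m * g q := by
  refine and_congr_right fun _ ↦ exists_congr fun g ↦ eventually_congr ?_
  filter_upwards [D.F_eq, along_f_eq D.F_eq X] with q h1 h2
  rw [h1, h2]

/-- The `b^m`-vector field `f^m N`. -/
def E : B.VectorFields :=
  ⟨(D.F ^ B.m) • D.N, D.mem_vectorFields_iff.2 ⟨smoothField_smul _ D.smooth_N, 1, by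
    filter_upwards [D.along_N] with q hq
    rw [along_smul_field, hq]; rfl⟩⟩

theorem E_apply (q : M) : (D.E : RawField M) q = D.F q ^ B.m • D.N q := rfl

theorem E_eq_zero {p : M} (hp : p ∈ B.Z) : (D.E : RawField M) p = 0 := by
  rw [E_apply, D.F_eq_zero hp, zero_pow (Nat.one_le_iff_ne_zero.1 B.one_le_m), zero_smul]

theorem along_E : ∀ᶠ q in 𝓝ˢ B.Z, along (D.E : RawField M) D.F q = D.F q ^ B.m := by
  filter_upwards [D.along_N] with q hq
  have := along_smul_field (D.F ^ B.m) D.N D.F q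
  rw [hq, mul_one] at this
  exact this

/-- A `b^m`-vector field tangent to the levels of the defining function near `Z`. -/
def Tan (V : B.VectorFields) : Prop := ∀ᶠ q in 𝓝ˢ B.Z, along (V : RawField M) D.F q = 0

/-- The coefficient is the function `g` of the condition `X(f) = f^m g`. -/
theorem exists_decomposition (X : B.VectorFields) :
    ∃ (g : SmoothFun M) (V : B.VectorFields), D.Tan V ∧ X = g • D.E + V := by
  obtain ⟨g, hg⟩ := (D.mem_vectorFields_iff.1 X.2).2
  refine ⟨g, X - g • D.E, ?_, by rw [add_sub_cancel]⟩
  filter_upwards [hg, D.along_E] with q h1 h2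
  have h3 := along_sub_field (X : RawField M) (g • D.E : B.VectorFields) D.F q
  have h4 := along_smul_field g (D.E : RawField M) D.F q
  rw [Submodule.coe_sub, h3, Submodule.coe_smul, h4, h1, h2]
  ring

variable {D}

theorem apply_eq_of_decomposition {X V : B.VectorFields} {g : SmoothFun M} (h : X = g • D.E + V)
    {p : M} (hp : p ∈ B.Z) : (X : RawField M) p = (V : RawField M) p := by
  subst h
  change g p • (D.E : RawField M) p + (V : RawField M) p = _
  rw [D.E_eq_zero hp, smul_zero, zero_add]

variable [T2Space M] [SecondCountableTopology M]

/-- On `Z`, the form `dα(·, f^m N)` is the differential of the function `α(f^m N)`. -/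
theorem extDeriv_E (α : B.OneForms) {V : B.VectorFields} (hV : D.Tan V) {p : M} (hp : p ∈ B.Z) :
    extDeriv α V D.E p = along (V : RawField M) (α D.E) p := by
  have hL : mlieBracket (𝓡 3) (V : RawField M) D.N ∈ B.VectorFields := by
    refine D.mem_vectorFields_iff.2 ⟨smooth_bracket V.2.1 D.smooth_N, 0, ?_⟩
    filter_upwards [eventually_nhdsSet_eventually_nhds hV, eventually_nhdsSet_eventually_nhds D.along_N]
      with q h1 h2
    rw [along_bracket V.2.1 D.smooth_N D.F.contMDiff.contMDiffAt,
      along_congr (h := fun _ ↦ 1) _ h2, along_congr (h := fun _ ↦ 0) _ h1, along_const,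
      along_const]
    simp
  have hbr : ∀ᶠ q in 𝓝 p, (bracket V D.E : RawField M) q =
      ((D.F ^ B.m • (⟨_, hL⟩ : B.VectorFields) : B.VectorFields) : RawField M) q := by
    filter_upwards [hV.filter_mono (nhds_le_nhdsSet hp)] with q hq
    have h1 := bracket_smul (Y := (V : RawField M)) D.smooth_N
      (smoothFun_mdifferentiableAt (D.F ^ B.m) q)
    have h2 : along (V : RawField M) (D.F ^ B.m : SmoothFun M) q = 0 := by
      have := along_pow (V : RawField M) (smoothFun_mdifferentiableAt D.F q) B.m
      rw [hq, mul_zero] at this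
      exact this
    rw [h2, zero_smul, zero_add] at h1
    exact h1
  rw [extDeriv_apply, along_of_field_eq_zero _ (D.E_eq_zero hp), form_apply_congr α hbr,
    form_smul_apply]
  have : (D.F ^ B.m : SmoothFun M) p = 0 := by
    change D.F p ^ B.m = 0
    rw [D.F_eq_zero hp, zero_pow (Nat.one_le_iff_ne_zero.1 B.one_le_m)]
  rw [this]; ring

end Transverse

/-- A frame whose first coordinate is the defining function, so that the other two coordinates
parametrize `Z`. The corresponding coordinate vector fields are realised, on the domain of the
chart, by `b^m`-vector fields tangent to the levels of the defining function. -/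
structure SliceFrame (D : B.Transverse) extends Frame M where
  coord_zero : coord 0 = D.F
  mem_Z_iff : ∀ q ∈ chart.source, D.F q = 0 ↔ q ∈ B.Z
  /-- the tangential coordinate fields -/
  tan : Fin 2 → B.VectorFields
  tan_mem : ∀ i, D.Tan (tan i)
  tan_eq : ∀ i, ∀ q ∈ chart.source, (tan i : RawField M) q = field i.succ q

theorem exists_sliceFrame_of_frame (D : B.Transverse) (Φ : Frame M) (h0 : Φ.coord 0 = D.F)
    {p : M} (hp : p ∈ Φ.chart.source) (hpZ : p ∈ B.Z) :
    ∃ Ψ : SliceFrame D, Ψ.coord = Φ.coord ∧ p ∈ Ψ.chart.source := by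
  obtain ⟨U, hU, hZU, hUZ⟩ := eventually_nhdsSet_iff_exists.1 D.F_eq_zero_iff
  -- subtracting a multiple of `N` makes the coordinate fields tangent to the levels everywhere
  let k : Fin 3 → SmoothFun M := fun i ↦
    ⟨along (Φ.field i) D.F, fun _ ↦ smooth_along (Φ.smooth_field i) D.F.contMDiff.contMDiffAt⟩
  have hk : ∀ i : Fin 2, ∀ q ∈ Φ.chart.source, k i.succ q = 0 := by
    intro i q hq
    have := Φ.along_field i.succ 0 q hq
    rw [h0, if_neg (Fin.succ_ne_zero i)] at this
    exact this
  have htan : ∀ i, ∀ᶠ q in 𝓝ˢ B.Z, along (Φ.field i - k i • D.N) D.F q = 0 := by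
    intro i
    filter_upwards [D.along_N] with q hq
    rw [along_sub_field, along_smul_field, hq, mul_one]
    exact sub_self _
  have hmem : ∀ i, Φ.field i - k i • D.N ∈ B.VectorFields := fun i ↦
    D.mem_vectorFields_iff.2 ⟨smoothField_sub (Φ.smooth_field i) (smoothField_smul _ D.smooth_N), 0,
      (htan i).mono fun q hq ↦ by rw [hq]; exact (mul_zero _).symm⟩
  refine ⟨⟨Φ.restr U hU, h0, fun q hq ↦ hUZ q hq.2, fun i ↦ ⟨_, hmem i.succ⟩,
    fun i ↦ htan i.succ, fun i q hq ↦ ?_⟩, rfl, ⟨hp, hZU hpZ⟩⟩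
  change Φ.field i.succ q - k i.succ q • D.N q = Φ.field i.succ q
  rw [hk i q hq.1, zero_smul, sub_zero]

namespace SliceFrame

variable {D : B.Transverse} (Ψ : SliceFrame D)

theorem tan_expansion {V : B.VectorFields} (hV : D.Tan V) {p : M} (hp : p ∈ B.Z)
    (hpΨ : p ∈ Ψ.chart.source) : ∀ᶠ q in 𝓝 p, (V : RawField M) q =
      ((deriv V (Ψ.coord 1) • Ψ.tan 0 + deriv V (Ψ.coord 2) • Ψ.tan 1 : B.VectorFields) :
        RawField M) q := by
  filter_upwards [hV.filter_mono (nhds_le_nhdsSet hp), Ψ.chart.open_source.mem_nhds hpΨ]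
    with q h1 h2
  have h := Ψ.field_expansion (V : RawField M) h2
  rw [Ψ.coord_zero, h1, zero_smul, zero_add] at h
  rw [h]
  change _ = along (V : RawField M) (Ψ.coord 1) q • (Ψ.tan 0 : RawField M) q +
    along (V : RawField M) (Ψ.coord 2) q • (Ψ.tan 1 : RawField M) q
  rw [Ψ.tan_eq 0 q h2, Ψ.tan_eq 1 q h2]
  rfl

theorem along_tan (i : Fin 2) (j : Fin 3) {q : M} (hq : q ∈ Ψ.chart.source) :
    along (Ψ.tan i : RawField M) (Ψ.coord j) q = if i.succ = j then 1 else 0 := by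
  rw [along_congr_field _ (Ψ.tan_eq i q hq)]
  exact Ψ.along_field _ _ q hq

end SliceFrame

variable [T2Space M] [SecondCountableTopology M]

theorem exists_sliceFrame (D : B.Transverse) {p : M} (hp : p ∈ B.Z) :
    ∃ Ψ : SliceFrame D, p ∈ Ψ.chart.source := by
  obtain ⟨Φ, h0, hpΦ⟩ := exists_frame_of_one D.F p (mvfderiv_ne_zero D.F_eq hp)
  obtain ⟨Ψ, -, h⟩ := exists_sliceFrame_of_frame D Φ h0 hpΦ hp
  exact ⟨Ψ, h⟩

namespace SliceFrame

variable {D : B.Transverse} (Ψ : SliceFrame D)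

theorem form_apply (α : B.OneForms) {V : B.VectorFields} (hV : D.Tan V) {p : M} (hp : p ∈ B.Z)
    (hpΨ : p ∈ Ψ.chart.source) : α V p = along (V : RawField M) (Ψ.coord 1) p * α (Ψ.tan 0) p +
      along (V : RawField M) (Ψ.coord 2) p * α (Ψ.tan 1) p := by
  rw [form_apply_congr α (Ψ.tan_expansion hV hp hpΨ), form_add_apply, form_smul_apply,
    form_smul_apply]
  rfl

theorem extDeriv_apply (α : B.OneForms) {V : B.VectorFields} (hV : D.Tan V) (W : B.VectorFields)
    {p : M} (hp : p ∈ B.Z) (hpΨ : p ∈ Ψ.chart.source) :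
    extDeriv α V W p = along (V : RawField M) (Ψ.coord 1) p * extDeriv α (Ψ.tan 0) W p +
      along (V : RawField M) (Ψ.coord 2) p * extDeriv α (Ψ.tan 1) W p := by
  rw [extDeriv_apply_congr α W (Ψ.tan_expansion hV hp hpΨ), extDeriv_add_left_apply,
    extDeriv_smul_left_apply, extDeriv_smul_left_apply]
  rfl

theorem form_bracket_tan (α : B.OneForms) {q : M} (hq : q ∈ Ψ.chart.source) :
    α (bracket (Ψ.tan 0) (Ψ.tan 1)) q = 0 := by
  apply form_apply_eq_zero
  filter_upwards [Ψ.chart.open_source.mem_nhds hq] with r hr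
  have e : ∀ i, (Ψ.tan i : RawField M) =ᶠ[𝓝 r] Ψ.field i.succ := fun i ↦ by
    filter_upwards [Ψ.chart.open_source.mem_nhds hr] with s hs using Ψ.tan_eq i s hs
  exact ((e 0).mlieBracket_vectorField_eq (e 1)).trans (Ψ.mlieBracket_field _ _ hr)

/-- The coefficient of `α ∧ dα` in the frame given by `f^m N` and the coordinate fields of `Z`. -/
theorem wedge_tan (α : B.OneForms) {p : M} (hp : p ∈ B.Z) :
    wedgeExtDeriv α D.E (Ψ.tan 0) (Ψ.tan 1) p =
      α D.E p * extDeriv α (Ψ.tan 0) (Ψ.tan 1) p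
      + α (Ψ.tan 0) p * along (Ψ.tan 1 : RawField M) (α D.E) p
      - α (Ψ.tan 1) p * along (Ψ.tan 0 : RawField M) (α D.E) p := by
  rw [wedgeExtDeriv_apply, extDeriv_swap_apply α D.E, Transverse.extDeriv_E α (Ψ.tan_mem 0) hp,
    Transverse.extDeriv_E α (Ψ.tan_mem 1) hp]
  ring

/-- Since `f^m N` and the two coordinate fields of `Z` span the `b^m`-tangent bundle along `Z`,
the contact condition can be tested on them. -/
theorem wedge_ne_zero {α : B.OneForms} (hα : IsContactForm α) {p : M} (hp : p ∈ B.Z)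
    (hpΨ : p ∈ Ψ.chart.source) : wedgeExtDeriv α D.E (Ψ.tan 0) (Ψ.tan 1) p ≠ 0 := by
  intro h0
  have key : ∀ X : B.VectorFields, ∃ x₀ x₁ x₂ : ℝ,
      α X p = x₀ * α D.E p + x₁ * α (Ψ.tan 0) p + x₂ * α (Ψ.tan 1) p ∧
      ∀ W, extDeriv α X W p = x₀ * extDeriv α D.E W p + x₁ * extDeriv α (Ψ.tan 0) W p
        + x₂ * extDeriv α (Ψ.tan 1) W p := by
    intro X
    obtain ⟨g, V, hV, rfl⟩ := D.exists_decomposition X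
    refine ⟨g p, along (V : RawField M) (Ψ.coord 1) p, along (V : RawField M) (Ψ.coord 2) p, ?_,
      fun W ↦ ?_⟩
    · rw [form_add_apply, form_smul_apply, Ψ.form_apply α hV hp hpΨ]; ring
    · rw [extDeriv_add_left_apply, extDeriv_smul_left_apply, Ψ.extDeriv_apply α hV W hp hpΨ]; ring
  obtain ⟨X, Y, W, h⟩ := hα p
  refine h ?_
  obtain ⟨x₀, x₁, x₂, hx, hX⟩ := key X
  obtain ⟨y₀, y₁, y₂, hy, hY⟩ := key Y
  obtain ⟨w₀, w₁, w₂, hw, hW⟩ := key W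
  have sw := fun X Y : B.VectorFields ↦ extDeriv_swap_apply α X Y p
  have hE : ∀ V : B.VectorFields, ∀ x₀ x₁ x₂ : ℝ, (∀ W, extDeriv α V W p =
      x₀ * extDeriv α D.E W p + x₁ * extDeriv α (Ψ.tan 0) W p + x₂ * extDeriv α (Ψ.tan 1) W p) →
      extDeriv α D.E V p = x₁ * extDeriv α D.E (Ψ.tan 0) p + x₂ * extDeriv α D.E (Ψ.tan 1) p ∧
      extDeriv α (Ψ.tan 0) V p =
        - x₀ * extDeriv α D.E (Ψ.tan 0) p + x₂ * extDeriv α (Ψ.tan 0) (Ψ.tan 1) p ∧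
      extDeriv α (Ψ.tan 1) V p =
        - x₀ * extDeriv α D.E (Ψ.tan 1) p - x₁ * extDeriv α (Ψ.tan 0) (Ψ.tan 1) p := by
    intro V x₀ x₁ x₂ hV
    rw [sw D.E V, sw (Ψ.tan 0) V, sw (Ψ.tan 1) V, hV, hV, hV, extDeriv_self, extDeriv_self,
      extDeriv_self, sw (Ψ.tan 0) D.E, sw (Ψ.tan 1) D.E, sw (Ψ.tan 1) (Ψ.tan 0)]
    refine ⟨by ring, by ring, by ring⟩
  obtain ⟨a1, a2, a3⟩ := hE X _ _ _ hX
  obtain ⟨b1, b2, b3⟩ := hE Y _ _ _ hY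
  obtain ⟨c1, c2, c3⟩ := hE W _ _ _ hW
  rw [wedgeExtDeriv_apply, sw (Ψ.tan 1)] at h0
  rw [wedgeExtDeriv_apply, hX, hY, hW, hx, hy, hw, a1, a2, a3, b1, b2, b3, c1, c2, c3]
  linear_combination (x₀ * (y₁ * w₂ - y₂ * w₁) - x₁ * (y₀ * w₂ - y₂ * w₀)
    + x₂ * (y₀ * w₁ - y₁ * w₀)) * h0

end SliceFrame

section Reeb

variable {D : B.Transverse} {α : B.OneForms} {R : B.VectorFields}

/-- Along `Z` the Reeb field is tangent to the levels of `α(f^m N)`. -/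
theorem along_reeb_eq_zero (hR : IsReebField α R) (D : B.Transverse) {p : M} (hp : p ∈ B.Z) :
    along (R : RawField M) (α D.E) p = 0 := by
  obtain ⟨g, V, hV, h⟩ := D.exists_decomposition R
  have h1 : extDeriv α R D.E p = 0 := by rw [hR.2]; rfl
  rw [along_congr_field _ (Transverse.apply_eq_of_decomposition h hp),
    ← Transverse.extDeriv_E α hV hp]
  rwa [h, extDeriv_add_left_apply, extDeriv_smul_left_apply, extDeriv_self, mul_zero,
    zero_add] at h1

/-- At a zero of the Reeb field on `Z`, the function `α(f^m N)` does not vanish. -/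
theorem form_E_ne_zero_of_reeb_eq_zero (hR : IsReebField α R) (D : B.Transverse) {p : M}
    (hp : p ∈ B.Z) (h0 : (R : RawField M) p = 0) : α D.E p ≠ 0 := by
  obtain ⟨g, V, hV, h⟩ := D.exists_decomposition R
  obtain ⟨Ψ, hpΨ⟩ := exists_sliceFrame D hp
  have hV0 : (V : RawField M) p = 0 := by
    rw [← Transverse.apply_eq_of_decomposition h hp, h0]
  have h1 : α R p = 1 := by rw [hR.1]; rfl
  rw [h, form_add_apply, form_smul_apply, Ψ.form_apply α hV hp hpΨ, along_of_field_eq_zero _ hV0,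
    along_of_field_eq_zero _ hV0] at h1
  intro h2
  rw [h2] at h1
  norm_num at h1

/-- Where the Reeb field does not vanish on `Z`, the function `α(f^m N)` restricted to `Z` has
nonzero differential. -/
theorem exists_along_ne_zero (hα : IsContactForm α) (hR : IsReebField α R) (D : B.Transverse)
    {p : M} (hp : p ∈ B.Z) (h0 : (R : RawField M) p ≠ 0) :
    ∃ W : B.VectorFields, D.Tan W ∧ along (W : RawField M) (α D.E) p ≠ 0 := by
  by_contra! hall
  obtain ⟨g, V, hV, h⟩ := D.exists_decomposition R
  obtain ⟨Ψ, hpΨ⟩ := exists_sliceFrame D hp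
  have hw := Ψ.wedge_ne_zero hα hp hpΨ
  rw [Ψ.wedge_tan α hp, hall _ (Ψ.tan_mem 0), hall _ (Ψ.tan_mem 1), mul_zero, mul_zero, add_zero,
    sub_zero] at hw
  have hd := right_ne_zero_of_mul hw
  have hRW : ∀ W, D.Tan W → extDeriv α V W p = 0 := by
    intro W hW
    have h1 : extDeriv α R W p = 0 := by rw [hR.2]; rfl
    rwa [h, extDeriv_add_left_apply, extDeriv_smul_left_apply, extDeriv_swap_apply α D.E,
      Transverse.extDeriv_E α hW hp, hall W hW, neg_zero, mul_zero, zero_add] at h1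
  have e1 := hRW _ (Ψ.tan_mem 0)
  have e2 := hRW _ (Ψ.tan_mem 1)
  rw [Ψ.extDeriv_apply α hV _ hp hpΨ, extDeriv_self] at e1 e2
  rw [extDeriv_swap_apply, mul_zero, zero_add, mul_neg, neg_eq_zero] at e1
  rw [mul_zero, add_zero] at e2
  have v2 := (mul_eq_zero.1 e1).resolve_right hd
  have v1 := (mul_eq_zero.1 e2).resolve_right hd
  refine h0 ?_
  rw [Transverse.apply_eq_of_decomposition h hp, (Ψ.tan_expansion hV hp hpΨ).self_of_nhds]
  change along (V : RawField M) (Ψ.coord 1) p • (Ψ.tan 0 : RawField M) p +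
    along (V : RawField M) (Ψ.coord 2) p • (Ψ.tan 1 : RawField M) p = 0
  rw [v1, v2, zero_smul, zero_smul, add_zero]

end Reeb

end BmStructure
end BmContact

/-! ### Parametrizations of the critical surface and Stokes' theorem in a chart -/

namespace BmContact

section Plane

open MeasureTheory

/-- Stokes' theorem in the plane for compactly supported functions. -/
theorem integral_fderiv_eq_zero {g : ℝ × ℝ → ℝ} (hg : ContDiff ℝ ∞ g) (hc : HasCompactSupport g)
    (v : ℝ × ℝ) : ∫ y, fderiv ℝ g y v = 0 := by
  have h1 : Continuous fun y ↦ fderiv ℝ g y v :=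
    (hg.continuous_fderiv (by simp)).clm_apply continuous_const
  have h2 : HasCompactSupport fun y ↦ fderiv ℝ g y v :=
    (hc.fderiv (𝕜 := ℝ)).comp_left (g := fun L : ℝ × ℝ →L[ℝ] ℝ ↦ L v) rfl
  have h := integral_mul_fderiv_eq_neg_fderiv_mul_of_integrable (𝕜 := ℝ) (μ := volume)
    (f := fun _ : ℝ × ℝ ↦ (1 : ℝ)) (g := g) (v := v) (by simp)
    (by simpa using h1.integrable_of_hasCompactSupport h2)
    (by simpa using hg.continuous.integrable_of_hasCompactSupport hc)
    (fun _ _ ↦ differentiableAt_const _) (fun y _ ↦ (hg.differentiable (by simp)) y)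
  simpa using h

theorem det_fin_two_prod (L : ℝ × ℝ →L[ℝ] ℝ × ℝ) :
    L.det = (L (1, 0)).1 * (L (0, 1)).2 - (L (0, 1)).1 * (L (1, 0)).2 := by
  rw [ContinuousLinearMap.det, ← LinearMap.det_toMatrix (Module.Basis.finTwoProd ℝ),
    Matrix.det_fin_two]
  simp [LinearMap.toMatrix_apply]

end Plane

variable {M : Type*} [TopologicalSpace M] [ChartedSpace (EuclideanSpace ℝ (Fin 3)) M]
  [IsManifold (𝓡 3) ∞ M]

namespace BmStructure

variable {B : BmStructure M}

namespace SliceFrame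

variable {D : B.Transverse} (Ψ : SliceFrame D)

/-- The parametrization of the part of `Z` inside the domain of the chart. -/
def slice (y : ℝ × ℝ) : M := Ψ.chart.symm (0, y)

/-- The domain of the parametrization `slice`. -/
def dom : Set (ℝ × ℝ) := {y | ((0 : ℝ), y) ∈ Ψ.chart.target}

/-- The two coordinates on `Z`. -/
def proj (q : M) : ℝ × ℝ := (Ψ.coord 1 q, Ψ.coord 2 q)

theorem isOpen_dom : IsOpen Ψ.dom := Ψ.chart.open_target.preimage (by fun_prop)

theorem chart_apply {q : M} (hq : q ∈ Ψ.chart.source) : Ψ.chart q = (D.F q, Ψ.proj q) := by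
  rw [Ψ.chart_eq q hq, coordMap, Ψ.coord_zero]; rfl

theorem slice_mem_source {y : ℝ × ℝ} (hy : y ∈ Ψ.dom) : Ψ.slice y ∈ Ψ.chart.source :=
  Ψ.chart.map_target hy

theorem chart_slice {y : ℝ × ℝ} (hy : y ∈ Ψ.dom) :
    (D.F (Ψ.slice y), Ψ.proj (Ψ.slice y)) = ((0 : ℝ), y) := by
  rw [← Ψ.chart_apply (Ψ.slice_mem_source hy)]
  exact Ψ.chart.right_inv hy

theorem proj_slice {y : ℝ × ℝ} (hy : y ∈ Ψ.dom) : Ψ.proj (Ψ.slice y) = y :=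
  congrArg Prod.snd (Ψ.chart_slice hy)

theorem slice_mem_Z {y : ℝ × ℝ} (hy : y ∈ Ψ.dom) : Ψ.slice y ∈ B.Z :=
  (Ψ.mem_Z_iff _ (Ψ.slice_mem_source hy)).1 (congrArg Prod.fst (Ψ.chart_slice hy))

theorem chart_eq_of_mem_Z {q : M} (hq : q ∈ Ψ.chart.source) (hZ : q ∈ B.Z) :
    Ψ.chart q = (0, Ψ.proj q) := by
  rw [Ψ.chart_apply hq, D.F_eq_zero hZ]

theorem proj_mem_dom {q : M} (hq : q ∈ Ψ.chart.source) (hZ : q ∈ B.Z) : Ψ.proj q ∈ Ψ.dom := by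
  have := Ψ.chart.map_source hq
  rwa [Ψ.chart_eq_of_mem_Z hq hZ] at this

theorem slice_proj {q : M} (hq : q ∈ Ψ.chart.source) (hZ : q ∈ B.Z) :
    Ψ.slice (Ψ.proj q) = q := by
  rw [slice, ← Ψ.chart_eq_of_mem_Z hq hZ, Ψ.chart.left_inv hq]

theorem contMDiffAt_slice {y : ℝ × ℝ} (hy : y ∈ Ψ.dom) :
    ContMDiffAt 𝓘(ℝ, ℝ × ℝ) (𝓡 3) ∞ Ψ.slice y := by
  have h1 := Ψ.contMDiffOn_symm.contMDiffAt (Ψ.chart.open_target.mem_nhds hy)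
  have h2 : ContDiff ℝ ∞ fun y : ℝ × ℝ ↦ ((0 : ℝ), y) := by fun_prop
  exact h1.comp y h2.contMDiff.contMDiffAt

theorem contDiffAt_comp_slice {k : M → ℝ} {y : ℝ × ℝ} (hy : y ∈ Ψ.dom)
    (hk : ContMDiffAt (𝓡 3) 𝓘(ℝ, ℝ) ∞ k (Ψ.slice y)) : ContDiffAt ℝ ∞ (k ∘ Ψ.slice) y :=
  (hk.comp y (Ψ.contMDiffAt_slice hy)).contDiffAt

theorem continuous_proj : Continuous Ψ.proj :=
  (Ψ.coord 1).contMDiff.continuous.prodMk (Ψ.coord 2).contMDiff.continuous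

theorem mfderiv_slice {y : ℝ × ℝ} (hy : y ∈ Ψ.dom) (i : Fin 2) :
    mfderiv 𝓘(ℝ, ℝ × ℝ) (𝓡 3) Ψ.slice y (if i = 0 then (1, 0) else (0, 1) : ℝ × ℝ) =
      (Ψ.tan i : RawField M) (Ψ.slice y) := by
  set e : ℝ × ℝ := if i = 0 then (1, 0) else (0, 1) with he
  have hs : MDifferentiableAt 𝓘(ℝ, ℝ × ℝ) (𝓡 3) Ψ.slice y :=
    (Ψ.contMDiffAt_slice hy).mdifferentiableAt (by simp)
  refine sub_eq_zero.1 (Ψ.eq_zero _ (Ψ.slice_mem_source hy) _ fun j ↦ ?_)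
  rw [map_sub, sub_eq_zero]
  have h1 := mvfderiv_comp_apply y (smoothFun_mdifferentiableAt (Ψ.coord j) (Ψ.slice y)) hs e
  rw [← h1]
  have h2 := Ψ.along_tan i j (Ψ.slice_mem_source hy)
  rw [along] at h2
  rw [h2]
  have h3 : mfderiv 𝓘(ℝ, ℝ × ℝ) 𝓘(ℝ, ℝ) (Ψ.coord j ∘ Ψ.slice) y e =
      fderiv ℝ (Ψ.coord j ∘ Ψ.slice) y e := by rw [mfderiv_eq_fderiv]; rfl
  refine h3.trans ?_
  have hev : ∀ᶠ z in 𝓝 y, (D.F (Ψ.slice z), Ψ.proj (Ψ.slice z)) = ((0 : ℝ), z) :=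
    Filter.eventually_of_mem (Ψ.isOpen_dom.mem_nhds hy) fun z hz ↦ Ψ.chart_slice hz
  fin_cases j
  · have h4 : (Ψ.coord 0 ∘ Ψ.slice : ℝ × ℝ → ℝ) =ᶠ[𝓝 y] fun _ ↦ 0 := hev.mono fun z hz ↦ by
      rw [Function.comp_apply, Ψ.coord_zero]; exact congrArg Prod.fst hz
    change fderiv ℝ (Ψ.coord 0 ∘ Ψ.slice) y e = _
    rw [h4.fderiv_eq]
    fin_cases i <;> simp
  · have h4 : (Ψ.coord 1 ∘ Ψ.slice : ℝ × ℝ → ℝ) =ᶠ[𝓝 y] fun z ↦ z.1 := hev.mono fun z hz ↦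
      congrArg (fun w : ℝ × ℝ × ℝ ↦ w.2.1) hz
    change fderiv ℝ (Ψ.coord 1 ∘ Ψ.slice) y e = _
    rw [h4.fderiv_eq, fderiv_fst]
    fin_cases i <;> simp [e]
  · have h4 : (Ψ.coord 2 ∘ Ψ.slice : ℝ × ℝ → ℝ) =ᶠ[𝓝 y] fun z ↦ z.2 := hev.mono fun z hz ↦
      congrArg (fun w : ℝ × ℝ × ℝ ↦ w.2.2) hz
    change fderiv ℝ (Ψ.coord 2 ∘ Ψ.slice) y e = _
    rw [h4.fderiv_eq, fderiv_snd]
    fin_cases i <;> simp [e]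

/-- The coordinate fields of the frame are the partial derivatives in the parametrization. -/
theorem fderiv_comp_slice {k : M → ℝ} {y : ℝ × ℝ} (hy : y ∈ Ψ.dom)
    (hk : MDifferentiableAt (𝓡 3) 𝓘(ℝ, ℝ) k (Ψ.slice y)) (i : Fin 2) :
    fderiv ℝ (k ∘ Ψ.slice) y (if i = 0 then (1, 0) else (0, 1) : ℝ × ℝ) =
      along (Ψ.tan i : RawField M) k (Ψ.slice y) := by
  have hs : MDifferentiableAt 𝓘(ℝ, ℝ × ℝ) (𝓡 3) Ψ.slice y :=
    (Ψ.contMDiffAt_slice hy).mdifferentiableAt (by simp)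
  have h1 := mvfderiv_comp_apply y hk hs (if i = 0 then (1, 0) else (0, 1) : ℝ × ℝ)
  rw [Ψ.mfderiv_slice hy] at h1
  rw [along, ← h1]
  change _ = mfderiv 𝓘(ℝ, ℝ × ℝ) 𝓘(ℝ, ℝ) (k ∘ Ψ.slice) y _
  rw [mfderiv_eq_fderiv]
  rfl

/-- A function on `M`, read in the parametrization of `Z` and extended by zero. -/
def pull (k : M → ℝ) : ℝ × ℝ → ℝ := Ψ.dom.indicator (k ∘ Ψ.slice)

theorem pull_eq_zero_near (hZ : IsCompact B.Z) {k : M → ℝ} {y : ℝ × ℝ}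
    (hy : y ∉ Ψ.proj '' (tsupport k ∩ B.Z)) : Ψ.pull k =ᶠ[𝓝 y] 0 := by
  have hK : IsCompact (Ψ.proj '' (tsupport k ∩ B.Z)) :=
    (hZ.inter_left (isClosed_tsupport k)).image Ψ.continuous_proj
  filter_upwards [hK.isClosed.isOpen_compl.mem_nhds hy] with z hz
  rw [pull, Pi.zero_apply, indicator_apply_eq_zero]
  intro hzd
  by_contra h
  exact hz ⟨Ψ.slice z, ⟨subset_tsupport k h, Ψ.slice_mem_Z hzd⟩, Ψ.proj_slice hzd⟩

theorem pull_eventuallyEq {k : M → ℝ} {y : ℝ × ℝ} (hy : y ∈ Ψ.dom) :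
    Ψ.pull k =ᶠ[𝓝 y] k ∘ Ψ.slice := by
  filter_upwards [Ψ.isOpen_dom.mem_nhds hy] with z hz
  exact indicator_of_mem hz _

theorem hasCompactSupport_pull (hZ : IsCompact B.Z) (k : M → ℝ) : HasCompactSupport (Ψ.pull k) := by
  have hK : IsCompact (Ψ.proj '' (tsupport k ∩ B.Z)) :=
    (hZ.inter_left (isClosed_tsupport k)).image Ψ.continuous_proj
  refine HasCompactSupport.intro hK fun y hy ↦ ?_
  exact (Ψ.pull_eq_zero_near hZ hy).self_of_nhds

theorem contDiff_pull (hZ : IsCompact B.Z) {k : M → ℝ} (hk : tsupport k ⊆ Ψ.chart.source)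
    (hs : ∀ q ∈ B.Z, q ∈ Ψ.chart.source → ContMDiffAt (𝓡 3) 𝓘(ℝ, ℝ) ∞ k q) :
    ContDiff ℝ ∞ (Ψ.pull k) := by
  rw [contDiff_iff_contDiffAt]
  intro y
  by_cases hy : y ∈ Ψ.dom
  · exact (Ψ.contDiffAt_comp_slice hy (hs _ (Ψ.slice_mem_Z hy)
      (Ψ.slice_mem_source hy))).congr_of_eventuallyEq (Ψ.pull_eventuallyEq hy)
  · refine contDiffAt_const (c := (0 : ℝ)) |>.congr_of_eventuallyEq (Ψ.pull_eq_zero_near hZ ?_)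
    rintro ⟨q, ⟨hq, hqZ⟩, rfl⟩
    exact hy (Ψ.proj_mem_dom (hk hq) hqZ)

open MeasureTheory

theorem integrable_pull (hZ : IsCompact B.Z) {k : M → ℝ} (hk : tsupport k ⊆ Ψ.chart.source)
    (hs : ∀ q ∈ B.Z, q ∈ Ψ.chart.source → ContMDiffAt (𝓡 3) 𝓘(ℝ, ℝ) ∞ k q) :
    Integrable (Ψ.pull k) :=
  (Ψ.contDiff_pull hZ hk hs).continuous.integrable_of_hasCompactSupport
    (Ψ.hasCompactSupport_pull hZ k)

theorem integral_pull (k : M → ℝ) : ∫ y, Ψ.pull k y = ∫ y in Ψ.dom, k (Ψ.slice y) :=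
  integral_indicator Ψ.isOpen_dom.measurableSet

/-- Stokes' theorem in the parametrization: a coordinate derivative of a function supported in the
chart has integral zero. -/
theorem integral_pull_along_tan (hZ : IsCompact B.Z) {k : M → ℝ}
    (hk : tsupport k ⊆ Ψ.chart.source)
    (hs : ∀ q ∈ B.Z, q ∈ Ψ.chart.source → ContMDiffAt (𝓡 3) 𝓘(ℝ, ℝ) ∞ k q) (i : Fin 2) :
    ∫ y, Ψ.pull (along (Ψ.tan i : RawField M) k) y = 0 := by
  rw [← integral_fderiv_eq_zero (Ψ.contDiff_pull hZ hk hs) (Ψ.hasCompactSupport_pull hZ k)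
    (if i = 0 then (1, 0) else (0, 1))]
  congr 1
  funext y
  by_cases hy : y ∈ Ψ.dom
  · rw [(Ψ.pull_eventuallyEq hy).fderiv_eq, Ψ.fderiv_comp_slice hy
      ((hs _ (Ψ.slice_mem_Z hy) (Ψ.slice_mem_source hy)).mdifferentiableAt (by simp))]
    exact indicator_of_mem hy _
  · have h0 : Ψ.pull k =ᶠ[𝓝 y] 0 := by
      refine Ψ.pull_eq_zero_near hZ ?_
      rintro ⟨q, ⟨hq, hqZ⟩, rfl⟩
      exact hy (Ψ.proj_mem_dom (hk hq) hqZ)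
    rw [h0.fderiv_eq, pull, indicator_of_notMem hy]
    simp

end SliceFrame

end BmStructure
end BmContact

/-! ### Change of chart and the exact area form -/

namespace BmContact

variable {M : Type*} [TopologicalSpace M] [ChartedSpace (EuclideanSpace ℝ (Fin 3)) M]
  [IsManifold (𝓡 3) ∞ M]

namespace BmStructure

variable {B : BmStructure M}

namespace SliceFrame

variable {D : B.Transverse} (Ψ Ψ' : SliceFrame D)

/-- The Jacobian determinant, at a point of `Z`, of the change of coordinates on `Z` from one slice
frame to another. -/
def jac (q : M) : ℝ :=
  along (Ψ.tan 0 : RawField M) (Ψ'.coord 1) q * along (Ψ.tan 1 : RawField M) (Ψ'.coord 2) q -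
  along (Ψ.tan 1 : RawField M) (Ψ'.coord 1) q * along (Ψ.tan 0 : RawField M) (Ψ'.coord 2) q

open MeasureTheory

/-- Change of variables between two parametrizations of `Z`, for densities whose coefficients are
related by the Jacobian determinant. -/
theorem integral_pull_eq {k k' : M → ℝ} {c : ℝ}
    (hk : ∀ q ∈ B.Z, q ∈ Ψ.chart.source → q ∉ Ψ'.chart.source → k q = 0)
    (hk' : ∀ q ∈ B.Z, q ∈ Ψ'.chart.source → q ∉ Ψ.chart.source → k' q = 0)
    (h : ∀ q ∈ B.Z, q ∈ Ψ.chart.source → q ∈ Ψ'.chart.source →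
      c * k q = |jac Ψ Ψ' q| * k' q) :
    c * ∫ y, Ψ.pull k y = ∫ y, Ψ'.pull k' y := by
  let S : Set (ℝ × ℝ) := Ψ.dom ∩ Ψ.slice ⁻¹' Ψ'.chart.source
  let S' : Set (ℝ × ℝ) := Ψ'.dom ∩ Ψ'.slice ⁻¹' Ψ.chart.source
  let τ : ℝ × ℝ → ℝ × ℝ := fun y ↦ Ψ'.proj (Ψ.slice y)
  have hcont : ContinuousOn Ψ.slice Ψ.dom := fun y hy ↦
    (Ψ.contMDiffAt_slice hy).continuousAt.continuousWithinAt
  have hS : IsOpen S := hcont.isOpen_inter_preimage Ψ.isOpen_dom Ψ'.chart.open_source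
  have hback : ∀ y ∈ S, Ψ'.slice (τ y) = Ψ.slice y := fun y hy ↦
    Ψ'.slice_proj hy.2 (Ψ.slice_mem_Z hy.1)
  have himg : τ '' S = S' := by
    ext z
    constructor
    · rintro ⟨y, hy, rfl⟩
      refine ⟨Ψ'.proj_mem_dom hy.2 (Ψ.slice_mem_Z hy.1), ?_⟩
      rw [mem_preimage, hback y hy]
      exact Ψ.slice_mem_source hy.1
    · intro hz
      have hzZ := Ψ'.slice_mem_Z hz.1
      have e := Ψ.slice_proj hz.2 hzZ
      refine ⟨Ψ.proj (Ψ'.slice z), ⟨Ψ.proj_mem_dom hz.2 hzZ, ?_⟩, ?_⟩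
      · rw [mem_preimage, e]; exact Ψ'.slice_mem_source hz.1
      · change Ψ'.proj (Ψ.slice (Ψ.proj (Ψ'.slice z))) = z
        rw [e, Ψ'.proj_slice hz.1]
  have hinj : InjOn τ S := by
    intro y hy z hz hyz
    have := (hback y hy).symm.trans ((congrArg Ψ'.slice hyz).trans (hback z hz))
    rw [← Ψ.proj_slice hy.1, this, Ψ.proj_slice hz.1]
  have hdc : ∀ j : Fin 3, ∀ y ∈ S, DifferentiableAt ℝ (Ψ'.coord j ∘ Ψ.slice) y := fun j y hy ↦
    (Ψ.contDiffAt_comp_slice hy.1 (Ψ'.coord j).contMDiff.contMDiffAt).differentiableAt (by simp)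
  have hder : ∀ y ∈ S, HasFDerivWithinAt τ (fderiv ℝ τ y) S y := fun y hy ↦
    (((hdc 1 y hy).prodMk (hdc 2 y hy)).hasFDerivAt.hasFDerivWithinAt :
      HasFDerivWithinAt τ (fderiv ℝ τ y) S y)
  have hdet : ∀ y ∈ S, (fderiv ℝ τ y).det = jac Ψ Ψ' (Ψ.slice y) := by
    intro y hy
    have e : fderiv ℝ τ y =
        (fderiv ℝ (Ψ'.coord 1 ∘ Ψ.slice) y).prod (fderiv ℝ (Ψ'.coord 2 ∘ Ψ.slice) y) :=
      (hdc 1 y hy).fderiv_prodMk (hdc 2 y hy)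
    have e' := fun (j : Fin 3) (i : Fin 2) ↦
      Ψ.fderiv_comp_slice hy.1 (smoothFun_mdifferentiableAt (Ψ'.coord j) _) i
    have e10 := e' 1 0
    have e20 := e' 2 0
    have e11 := e' 1 1
    have e21 := e' 2 1
    rw [if_pos rfl] at e10 e20
    rw [if_neg one_ne_zero] at e11 e21
    rw [det_fin_two_prod, e]
    simp only [ContinuousLinearMap.prod_apply]
    rw [e10, e20, e11, e21, jac]
  have hcov := integral_image_eq_integral_abs_det_fderiv_smul volume hS.measurableSet hder hinj
    (fun z ↦ k' (Ψ'.slice z))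
  rw [integral_pull, integral_pull,
    setIntegral_eq_of_subset_of_forall_sdiff_eq_zero (s := S) Ψ.isOpen_dom.measurableSet
      inter_subset_left,
    setIntegral_eq_of_subset_of_forall_sdiff_eq_zero (s := S') Ψ'.isOpen_dom.measurableSet
      inter_subset_left, ← himg, hcov, ← integral_const_mul]
  · refine setIntegral_congr_fun hS.measurableSet fun y hy ↦ ?_
    simp only [smul_eq_mul]
    rw [hdet y hy, hback y hy]
    exact h _ (Ψ.slice_mem_Z hy.1) (Ψ.slice_mem_source hy.1) hy.2
  · intro z hz
    exact hk' _ (Ψ'.slice_mem_Z hz.1) (Ψ'.slice_mem_source hz.1) fun h' ↦ hz.2 ⟨hz.1, h'⟩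
  · intro z hz
    exact hk _ (Ψ.slice_mem_Z hz.1) (Ψ.slice_mem_source hz.1) fun h' ↦ hz.2 ⟨hz.1, h'⟩

/-- The coefficient, in the coordinates of the frame, of the two-form `dr ∧ θ` on `Z`, where
`θ = α / α(f^m N)`. -/
def wedgeForm (α : B.OneForms) (r : M → ℝ) (q : M) : ℝ :=
  along (Ψ.tan 0 : RawField M) r q * (α (Ψ.tan 1) q / α D.E q) -
    along (Ψ.tan 1 : RawField M) r q * (α (Ψ.tan 0) q / α D.E q)

theorem contMDiffAt_wedgeForm (α : B.OneForms) (r : SmoothFun M) {q : M} (hu : α D.E q ≠ 0) :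
    ContMDiffAt (𝓡 3) 𝓘(ℝ, ℝ) ∞ (Ψ.wedgeForm α r) q := by
  have hA : ∀ i, ContMDiffAt (𝓡 3) 𝓘(ℝ, ℝ) ∞ (fun q ↦ α (Ψ.tan i) q / α D.E q) q := fun i ↦
    (α (Ψ.tan i)).contMDiff.contMDiffAt.div₀ (α D.E).contMDiff.contMDiffAt hu
  exact ((smooth_along (Ψ.tan 0).2.1 r.contMDiff.contMDiffAt).mul (hA 1)).sub
    ((smooth_along (Ψ.tan 1).2.1 r.contMDiff.contMDiffAt).mul (hA 0))

theorem tsupport_wedgeForm_subset (α : B.OneForms) (r : M → ℝ) :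
    tsupport (Ψ.wedgeForm α r) ⊆ tsupport r := by
  refine closure_minimal (fun q hq ↦ ?_) (isClosed_tsupport _)
  by_contra hq'
  have h0 : ∀ j, along (Ψ.tan j : RawField M) r q = 0 := fun j ↦
    image_eq_zero_of_notMem_tsupport fun h ↦ hq' (tsupport_along_subset _ _ h)
  refine hq ?_
  rw [wedgeForm, h0, h0, zero_mul, zero_mul, sub_zero]

variable [T2Space M] [SecondCountableTopology M]

/-- The coefficients of the two-form `dr ∧ θ` in two charts of `Z` differ by the Jacobian
determinant. -/
theorem wedgeForm_eq_jac_mul (α : B.OneForms) {r : M → ℝ} {q : M} (hq : q ∈ B.Z)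
    (hΨ' : q ∈ Ψ'.chart.source) :
    Ψ.wedgeForm α r q = jac Ψ Ψ' q * Ψ'.wedgeForm α r q := by
  have e : ∀ i, along (Ψ.tan i : RawField M) r q =
      along (Ψ.tan i : RawField M) (Ψ'.coord 1) q * along (Ψ'.tan 0 : RawField M) r q +
      along (Ψ.tan i : RawField M) (Ψ'.coord 2) q * along (Ψ'.tan 1 : RawField M) r q := by
    intro i
    rw [along_congr_field r (Ψ'.tan_expansion (Ψ.tan_mem i) hq hΨ').self_of_nhds, Submodule.coe_add,
      along_add_field, Submodule.coe_smul, Submodule.coe_smul, along_smul_field, along_smul_field]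
    rfl
  rw [wedgeForm, wedgeForm, e, e, Ψ'.form_apply α (Ψ.tan_mem 0) hq hΨ',
    Ψ'.form_apply α (Ψ.tan_mem 1) hq hΨ', jac]
  ring

/-- The two-form `(α ∧ dα)(f^m N, ·, ·)` on `Z` transforms with the Jacobian determinant. -/
theorem wedge_eq_jac_mul (α : B.OneForms) {q : M} (hq : q ∈ B.Z)
    (hΨ' : q ∈ Ψ'.chart.source) :
    wedgeExtDeriv α D.E (Ψ.tan 0) (Ψ.tan 1) q =
      jac Ψ Ψ' q * wedgeExtDeriv α D.E (Ψ'.tan 0) (Ψ'.tan 1) q := by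
  have e1 := fun i ↦ Ψ'.form_apply α (Ψ.tan_mem i) hq hΨ'
  have e2 := fun i W ↦ Ψ'.extDeriv_apply α (Ψ.tan_mem i) W hq hΨ'
  have e3 := fun i ↦ extDeriv_swap_apply α D.E (Ψ.tan i) q
  rw [wedgeExtDeriv_apply, wedgeExtDeriv_apply, e3 0, e1, e1, e2 1 D.E, e2 0 D.E, e2 0 (Ψ.tan 1),
    extDeriv_swap_apply α (Ψ'.tan 0) (Ψ.tan 1), extDeriv_swap_apply α (Ψ'.tan 1) (Ψ.tan 1), e2, e2,
    extDeriv_self, extDeriv_self, extDeriv_swap_apply α (Ψ'.tan 1) (Ψ'.tan 0),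
    extDeriv_swap_apply α D.E (Ψ'.tan 0), jac]
  ring

/-- Stokes' theorem for `r θ`, where `θ = α / α(f^m N)` and `r` is supported in the chart: since
`dθ` is the quotient of `α ∧ dα` by `α(f^m N)²`, the integrals of `r (α ∧ dα) / α(f^m N)²` and of
`- dr ∧ θ` agree. -/
theorem integral_wedge_eq_neg (hZ : IsCompact B.Z) (α : B.OneForms)
    (hu : ∀ q ∈ B.Z, α D.E q ≠ 0) (r : SmoothFun M) (hr : tsupport r ⊆ Ψ.chart.source) :
    ∫ y, Ψ.pull (fun q ↦ r q * (wedgeExtDeriv α D.E (Ψ.tan 0) (Ψ.tan 1) q / α D.E q ^ 2)) y =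
      - ∫ y, Ψ.pull (Ψ.wedgeForm α r) y := by
  let A : Fin 2 → M → ℝ := fun i q ↦ α (Ψ.tan i) q / α D.E q
  have hA : ∀ i, ∀ q ∈ B.Z, ContMDiffAt (𝓡 3) 𝓘(ℝ, ℝ) ∞ (A i) q := fun i q hq ↦
    (α (Ψ.tan i)).contMDiff.contMDiffAt.div₀ (α D.E).contMDiff.contMDiffAt (hu q hq)
  have hrA : ∀ i, ∀ q ∈ B.Z, ContMDiffAt (𝓡 3) 𝓘(ℝ, ℝ) ∞ (fun q ↦ r q * A i q) q := fun i q hq ↦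
    r.contMDiff.contMDiffAt.mul (hA i q hq)
  have hsup : ∀ k : M → ℝ, tsupport (fun q ↦ r q * k q) ⊆ Ψ.chart.source := fun k ↦
    (closure_mono (Function.support_subset_iff'.2 fun q hq ↦ by
      rw [Function.notMem_support.1 hq, zero_mul])).trans hr
  have hst := fun i j ↦ Ψ.integral_pull_along_tan hZ (hsup (A i)) (fun q hq _ ↦ hrA i q hq) j
  have hint : ∀ i j, Integrable (Ψ.pull (along (Ψ.tan j : RawField M) fun q ↦ r q * A i q)) := by
    intro i j
    exact Ψ.integrable_pull hZ ((tsupport_along_subset _ _).trans (hsup (A i)))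
      fun q hq _ ↦ smooth_along (Ψ.tan j).2.1 (hrA i q hq)
  have hwint : Integrable (Ψ.pull (Ψ.wedgeForm α r)) :=
    Ψ.integrable_pull hZ ((Ψ.tsupport_wedgeForm_subset α r).trans hr) fun q hq _ ↦
      Ψ.contMDiffAt_wedgeForm α r (hu q hq)
  have key : ∀ y, Ψ.pull (fun q ↦ r q *
      (wedgeExtDeriv α D.E (Ψ.tan 0) (Ψ.tan 1) q / α D.E q ^ 2)) y =
      Ψ.pull (along (Ψ.tan 0 : RawField M) fun q ↦ r q * A 1 q) y -
      Ψ.pull (along (Ψ.tan 1 : RawField M) fun q ↦ r q * A 0 q) y - Ψ.pull (Ψ.wedgeForm α r) y := by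
    intro y
    by_cases hy : y ∈ Ψ.dom
    swap
    · simp only [pull, indicator_of_notMem hy, sub_zero]
    simp only [pull, indicator_of_mem hy, Function.comp_apply]
    have hq := Ψ.slice_mem_Z hy
    have hqs := Ψ.slice_mem_source hy
    set q := Ψ.slice y
    have hmA : ∀ i, MDifferentiableAt (𝓡 3) 𝓘(ℝ, ℝ) (A i) q := fun i ↦
      (hA i q hq).mdifferentiableAt (by simp)
    have hquot : ∀ i j, along (Ψ.tan j : RawField M) (α (Ψ.tan i)) q =
        along (Ψ.tan j : RawField M) (A i) q * α D.E q +
          A i q * along (Ψ.tan j : RawField M) (α D.E) q := by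
      intro i j
      rw [← along_mul _ (hmA i) (smoothFun_mdifferentiableAt (α D.E) q)]
      apply along_congr
      filter_upwards [(α D.E).contMDiff.continuous.continuousAt.eventually_ne (hu q hq)] with z hz
      exact (div_mul_cancel₀ _ hz).symm
    have hw := Ψ.wedge_tan α hq
    rw [BmStructure.extDeriv_apply, Ψ.form_bracket_tan α hqs, hquot, hquot] at hw
    rw [along_mul _ (smoothFun_mdifferentiableAt r q) (hmA _),
      along_mul _ (smoothFun_mdifferentiableAt r q) (hmA _), wedgeForm, hw]
    have hA' : ∀ i, α (Ψ.tan i) q = A i q * α D.E q := fun i ↦ (div_mul_cancel₀ _ (hu q hq)).symm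
    rw [hA' 0, hA' 1]
    have := hu q hq
    field_simp
    ring
  have h1 := integral_sub ((hint 1 0).sub (hint 0 1)) hwint
  have h2 := integral_sub (hint 1 0) (hint 0 1)
  simp only [Pi.sub_apply] at h1
  rw [integral_congr_ae (Eventually.of_forall key), h1, h2, hst, hst, sub_zero, zero_sub]

end SliceFrame

end BmStructure
end BmContact

/-! ### A zero of `α(f^m N)` on the critical surface -/

namespace BmContact

variable {M : Type*} [TopologicalSpace M] [ChartedSpace (EuclideanSpace ℝ (Fin 3)) M]
  [IsManifold (𝓡 3) ∞ M]

namespace BmStructure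

variable {B : BmStructure M}

namespace SliceFrame

variable {D : B.Transverse}

/-- The restriction of a slice frame to an open set. -/
def restrict (Ψ : SliceFrame D) (U : Set M) (hU : IsOpen U) : SliceFrame D where
  toFrame := Ψ.toFrame.restr U hU
  coord_zero := Ψ.coord_zero
  mem_Z_iff q hq := Ψ.mem_Z_iff q hq.1
  tan := Ψ.tan
  tan_mem := Ψ.tan_mem
  tan_eq i q hq := Ψ.tan_eq i q hq.1

/-- As the functions `ρ i` add up to one on `Z`, the two-forms `dρ_i ∧ θ` add up to zero. -/
theorem sum_wedgeForm_eq_zero {ι : Type*} [Fintype ι] (Ψ : SliceFrame D) (α : B.OneForms)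
    (ρ : ι → SmoothFun M) (hρ : ∀ q ∈ B.Z, ∑ i, ρ i q = 1) {q : M} (hq : q ∈ B.Z)
    (hqs : q ∈ Ψ.chart.source) : ∑ i, Ψ.wedgeForm α (ρ i) q = 0 := by
  have key : ∀ j, ∑ i, along (Ψ.tan j : RawField M) (ρ i) q = 0 := by
    intro j
    have hy := Ψ.proj_mem_dom hqs hq
    have hd : ∀ i, DifferentiableAt ℝ (ρ i ∘ Ψ.slice) (Ψ.proj q) := fun i ↦
      (Ψ.contDiffAt_comp_slice hy (ρ i).contMDiff.contMDiffAt).differentiableAt (by simp)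
    have h1 : ∀ i, along (Ψ.tan j : RawField M) (ρ i) q =
        fderiv ℝ (ρ i ∘ Ψ.slice) (Ψ.proj q) (if j = 0 then (1, 0) else (0, 1)) := by
      intro i
      rw [Ψ.fderiv_comp_slice hy (smoothFun_mdifferentiableAt (ρ i) _), Ψ.slice_proj hqs hq]
    have h2 : fderiv ℝ (fun y ↦ ∑ i, (ρ i ∘ Ψ.slice) y) (Ψ.proj q) = 0 := by
      have : (fun y ↦ ∑ i, (ρ i ∘ Ψ.slice) y) =ᶠ[𝓝 (Ψ.proj q)] fun _ ↦ 1 := by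
        filter_upwards [Ψ.isOpen_dom.mem_nhds hy] with z hz using hρ _ (Ψ.slice_mem_Z hz)
      rw [this.fderiv_eq]
      simp
    rw [fderiv_fun_sum fun i _ ↦ hd i] at h2
    simp only [h1]
    rw [← sum_apply, h2]
    rfl
  simp only [wedgeForm]
  rw [Finset.sum_sub_distrib, ← Finset.sum_mul, ← Finset.sum_mul, key, key]
  ring

variable [T2Space M] [SecondCountableTopology M]

/-- The sign `σ` compares the orientation of the chart with the one which `α ∧ dα` defines on `Z`.
-/
theorem exists_signed {α : B.OneForms} (hα : IsContactForm α) (D : B.Transverse) {p : M}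
    (hp : p ∈ B.Z) : ∃ (Ψ : SliceFrame D) (σ : ℝ), σ * σ = 1 ∧ p ∈ Ψ.chart.source ∧
      ∀ q ∈ Ψ.chart.source, 0 < σ * wedgeExtDeriv α D.E (Ψ.tan 0) (Ψ.tan 1) q := by
  obtain ⟨Ψ, hpΨ⟩ := exists_sliceFrame D hp
  have hne := Ψ.wedge_ne_zero hα hp hpΨ
  obtain ⟨σ, hσ, hpos⟩ : ∃ σ : ℝ, σ * σ = 1 ∧
      0 < σ * wedgeExtDeriv α D.E (Ψ.tan 0) (Ψ.tan 1) p := by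
    rcases lt_or_gt_of_ne hne with h | h
    · exact ⟨-1, by norm_num, by linarith⟩
    · exact ⟨1, by norm_num, by linarith⟩
  have hU : IsOpen {q | 0 < σ * wedgeExtDeriv α D.E (Ψ.tan 0) (Ψ.tan 1) q} :=
    isOpen_lt continuous_const
      (continuous_const.mul (wedgeExtDeriv α D.E (Ψ.tan 0) (Ψ.tan 1)).contMDiff.continuous)
  exact ⟨Ψ.restrict _ hU, σ, hσ, ⟨hpΨ, hpos⟩, fun q hq ↦ hq.2⟩

end SliceFrame

variable [T2Space M] [SecondCountableTopology M]

open MeasureTheory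

/-- The integral of `dθ` over `Z`, `θ = α / α(f^m N)`, computed with the partition of unity `ρ`
and the signs `σ`, is zero. -/
theorem sum_integral_eq_zero {ι : Type*} [Fintype ι] (hZ : IsCompact B.Z) {D : B.Transverse}
    (α : B.OneForms) (hu : ∀ q ∈ B.Z, α D.E q ≠ 0) (Ψ : ι → SliceFrame D) (σ : ι → ℝ)
    (hσ : ∀ i, σ i * σ i = 1) (hpos : ∀ i, ∀ q ∈ (Ψ i).chart.source,
      0 < σ i * wedgeExtDeriv α D.E ((Ψ i).tan 0) ((Ψ i).tan 1) q)
    (ρ : ι → SmoothFun M) (hρ : ∀ i, tsupport (ρ i) ⊆ (Ψ i).chart.source)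
    (hsum : ∀ q ∈ B.Z, ∑ i, ρ i q = 1) :
    ∑ i, σ i * ∫ y, (Ψ i).pull (fun q ↦
      ρ i q * (wedgeExtDeriv α D.E ((Ψ i).tan 0) ((Ψ i).tan 1) q / α D.E q ^ 2)) y = 0 := by
  -- the contribution of the function of index `j` to the integral over the chart of index `i`
  let Q : ι → ι → ι → M → ℝ := fun i j l q ↦ ρ j q * (Ψ l).wedgeForm α (ρ i) q
  have hQs : ∀ i j l, ∀ q ∈ B.Z, ContMDiffAt (𝓡 3) 𝓘(ℝ, ℝ) ∞ (Q i j l) q := fun i j l q hq ↦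
    (ρ j).contMDiff.contMDiffAt.mul ((Ψ l).contMDiffAt_wedgeForm α (ρ i) (hu q hq))
  have hQi : ∀ i j l, tsupport (Q i j l) ⊆ tsupport (ρ i) := fun i j l ↦
    (closure_mono (Function.support_mul_subset_right _ _)).trans
      ((Ψ l).tsupport_wedgeForm_subset α (ρ i))
  have hQj : ∀ i j l, tsupport (Q i j l) ⊆ tsupport (ρ j) := fun i j l ↦
    closure_mono (Function.support_mul_subset_left _ _)
  have hint1 : ∀ i j, Integrable ((Ψ i).pull (Q i j i)) := fun i j ↦
    (Ψ i).integrable_pull hZ ((hQi i j i).trans (hρ i)) fun q hq _ ↦ hQs i j i q hq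
  have hint2 : ∀ i j, Integrable ((Ψ j).pull (Q i j j)) := fun i j ↦
    (Ψ j).integrable_pull hZ ((hQj i j j).trans (hρ j)) fun q hq _ ↦ hQs i j j q hq
  have hswap : ∀ i j, σ i * ∫ y, (Ψ i).pull (Q i j i) y = σ j * ∫ y, (Ψ j).pull (Q i j j) y := by
    intro i j
    have h := (Ψ i).integral_pull_eq (Ψ j) (k := Q i j i) (k' := Q i j j) (c := σ i * σ j)
      (fun q _ _ h ↦ image_eq_zero_of_notMem_tsupport fun h' ↦ h (hρ j (hQj _ _ _ h')))
      (fun q _ _ h ↦ image_eq_zero_of_notMem_tsupport fun h' ↦ h (hρ i (hQi _ _ _ h')))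
      (fun q hq hi hj ↦ by
        have h1 := hpos i q hi
        have h2 := hpos j q hj
        rw [(Ψ i).wedge_eq_jac_mul (Ψ j) α hq hj] at h1
        have h3 : 0 < (σ i * σ j * SliceFrame.jac (Ψ i) (Ψ j) q) *
            (σ j * wedgeExtDeriv α D.E ((Ψ j).tan 0) ((Ψ j).tan 1) q) := by
          convert h1 using 1
          linear_combination (σ i * SliceFrame.jac (Ψ i) (Ψ j) q *
            wedgeExtDeriv α D.E ((Ψ j).tan 0) ((Ψ j).tan 1) q) * hσ j
        have h4 := (pos_iff_pos_of_mul_pos h3).2 h2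
        have h5 : |σ i * σ j| = 1 := by
          rcases mul_self_eq_one_iff.1 (hσ i) with a | a <;>
            rcases mul_self_eq_one_iff.1 (hσ j) with b | b <;> simp [a, b]
        have h6 : |SliceFrame.jac (Ψ i) (Ψ j) q| = σ i * σ j * SliceFrame.jac (Ψ i) (Ψ j) q := by
          rw [← abs_of_pos h4, abs_mul, h5, one_mul]
        simp only [Q]
        rw [h6, (Ψ i).wedgeForm_eq_jac_mul (Ψ j) α hq hj]
        ring)
    rw [← h]
    linear_combination (-(σ i * ∫ y, (Ψ i).pull (Q i j i) y)) * hσ j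
  have h1 : ∀ i, ∫ y, (Ψ i).pull (fun q ↦
      ρ i q * (wedgeExtDeriv α D.E ((Ψ i).tan 0) ((Ψ i).tan 1) q / α D.E q ^ 2)) y =
      - ∑ j, ∫ y, (Ψ i).pull (Q i j i) y := by
    intro i
    rw [(Ψ i).integral_wedge_eq_neg hZ α hu (ρ i) (hρ i),
      ← integral_finsetSum _ fun j _ ↦ hint1 i j]
    congr 2
    funext y
    by_cases hy : y ∈ (Ψ i).dom
    · simp only [SliceFrame.pull, indicator_of_mem hy, Function.comp_apply, Q]
      rw [← Finset.sum_mul, hsum _ ((Ψ i).slice_mem_Z hy), one_mul]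
    · simp only [SliceFrame.pull, indicator_of_notMem hy, Finset.sum_const_zero]
  have h2 : ∀ j, ∑ i, ∫ y, (Ψ j).pull (Q i j j) y = 0 := by
    intro j
    rw [← integral_finsetSum _ fun i _ ↦ hint2 i j, ← integral_zero (ℝ × ℝ) ℝ]
    congr 1
    funext y
    by_cases hy : y ∈ (Ψ j).dom
    · simp only [SliceFrame.pull, indicator_of_mem hy, Function.comp_apply, Q]
      rw [← Finset.mul_sum, (Ψ j).sum_wedgeForm_eq_zero α ρ hsum
        ((Ψ j).slice_mem_Z hy) ((Ψ j).slice_mem_source hy), mul_zero]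
    · simp only [SliceFrame.pull, indicator_of_notMem hy, Finset.sum_const_zero]
  calc _ = ∑ i, ∑ j, -(σ j * ∫ y, (Ψ j).pull (Q i j j) y) := by
        refine Finset.sum_congr rfl fun i _ ↦ ?_
        rw [h1, mul_neg, Finset.mul_sum, ← Finset.sum_neg_distrib]
        exact Finset.sum_congr rfl fun j _ ↦ by rw [hswap]
    _ = ∑ j, ∑ i, -(σ j * ∫ y, (Ψ j).pull (Q i j j) y) := Finset.sum_comm
    _ = 0 := Finset.sum_eq_zero fun j _ ↦ by
        rw [Finset.sum_neg_distrib, ← Finset.mul_sum, h2, mul_zero, neg_zero]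

/-- A closed surface carries no exact area form: hence `α(f^m N)` cannot be nonzero on all of `Z`,
as otherwise the form `d(α / α(f^m N))` would be one. -/
theorem exists_form_E_eq_zero (hZ : IsCompact B.Z) (hne : B.Z.Nonempty) {α : B.OneForms}
    (hα : IsContactForm α) (D : B.Transverse) : ∃ p ∈ B.Z, α D.E p = 0 := by
  classical
  have : LocallyCompactSpace M := ChartedSpace.locallyCompactSpace (EuclideanSpace ℝ (Fin 3)) M
  have : SigmaCompactSpace M := inferInstance
  by_contra! hu
  choose Ψ₀ σ₀ hσ₀ hmem₀ hpos₀ using fun p : B.Z ↦ SliceFrame.exists_signed hα D p.2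
  obtain ⟨t, ht⟩ := hZ.elim_finite_subcover (fun p : B.Z ↦ (Ψ₀ p).chart.source)
    (fun p ↦ (Ψ₀ p).chart.open_source) fun p hp ↦ mem_iUnion.2 ⟨⟨p, hp⟩, hmem₀ ⟨p, hp⟩⟩
  let Ψ : t → SliceFrame D := fun i ↦ Ψ₀ i
  let σ : t → ℝ := fun i ↦ σ₀ i
  have hσ : ∀ i, σ i * σ i = 1 := fun i ↦ hσ₀ i
  have hpos : ∀ i, ∀ q ∈ (Ψ i).chart.source,
      0 < σ i * wedgeExtDeriv α D.E ((Ψ i).tan 0) ((Ψ i).tan 1) q := fun i ↦ hpos₀ i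
  obtain ⟨ρ, hρ⟩ := SmoothPartitionOfUnity.exists_isSubordinate (𝓡 3) B.isClosed_Z
    (fun i : t ↦ (Ψ i).chart.source) (fun i ↦ (Ψ i).chart.open_source) (by
      intro p hp
      obtain ⟨i, hi, h⟩ := mem_iUnion₂.1 (ht hp)
      exact mem_iUnion.2 ⟨⟨i, hi⟩, h⟩)
  have hsum : ∀ q ∈ B.Z, ∑ i, ρ i q = 1 := fun q hq ↦ by
    rw [← finsum_eq_sum_of_fintype]; exact ρ.sum_eq_one hq
  let P : t → ℝ × ℝ → ℝ := fun i ↦ (Ψ i).pull fun q ↦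
    ρ i q * (wedgeExtDeriv α D.E ((Ψ i).tan 0) ((Ψ i).tan 1) q / α D.E q ^ 2)
  have hzero : ∑ i, σ i * ∫ y, P i y = 0 :=
    sum_integral_eq_zero hZ α hu Ψ σ hσ hpos (fun i ↦ ρ i) hρ hsum
  have hsupP : ∀ i, tsupport (fun q ↦
      ρ i q * (wedgeExtDeriv α D.E ((Ψ i).tan 0) ((Ψ i).tan 1) q / α D.E q ^ 2)) ⊆
      (Ψ i).chart.source := fun i ↦
    (closure_mono (Function.support_mul_subset_left _ _)).trans (hρ i)
  have hPc : ∀ i, Continuous (P i) := fun i ↦ ((Ψ i).contDiff_pull hZ (hsupP i) fun q hq _ ↦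
    (ρ i).contMDiff.contMDiffAt.mul ((wedgeExtDeriv α D.E _ _).contMDiff.contMDiffAt.div₀
      ((α D.E).contMDiff.contMDiffAt.pow 2) (pow_ne_zero 2 (hu q hq)))).continuous
  have hPs : ∀ i, HasCompactSupport (P i) := fun i ↦ (Ψ i).hasCompactSupport_pull hZ _
  have hP0 : ∀ i y, 0 ≤ σ i * P i y := by
    intro i y
    by_cases hy : y ∈ (Ψ i).dom
    · simp only [P, SliceFrame.pull, indicator_of_mem hy, Function.comp_apply]
      have := (hpos i _ ((Ψ i).slice_mem_source hy)).le
      calc (0 : ℝ) ≤ ρ i ((Ψ i).slice y) * ((σ i * wedgeExtDeriv α D.E ((Ψ i).tan 0) ((Ψ i).tan 1)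
            ((Ψ i).slice y)) / α D.E ((Ψ i).slice y) ^ 2) :=
            mul_nonneg (ρ.nonneg i _) (div_nonneg this (sq_nonneg _))
        _ = _ := by ring
    · simp only [P, SliceFrame.pull, indicator_of_notMem hy, mul_zero, le_refl]
  obtain ⟨p, hp⟩ := hne
  obtain ⟨i, hi⟩ := ρ.exists_pos_of_mem hp
  have hps : p ∈ (Ψ i).chart.source := hρ i (subset_tsupport _ hi.ne')
  have hterm : ∀ j, 0 ≤ σ j * ∫ y, P j y := fun j ↦ by
    rw [← integral_const_mul]; exact integral_nonneg (hP0 j)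
  have hlt : 0 < σ i * ∫ y, P i y := by
    rw [← integral_const_mul]
    refine Continuous.integral_pos_of_hasCompactSupport_nonneg_nonzero (x := (Ψ i).proj p)
      (continuous_const.mul (hPc i)) (hPs i).mul_left (hP0 i) ?_
    have hy := (Ψ i).proj_mem_dom hps hp
    simp only [P, SliceFrame.pull, indicator_of_mem hy, Function.comp_apply]
    rw [(Ψ i).slice_proj hps hp]
    have h1 := hpos i p hps
    have h2 := hu p hp
    have h3 := left_ne_zero_of_mul h1.ne'
    have h4 := right_ne_zero_of_mul h1.ne'
    exact mul_ne_zero h3 (mul_ne_zero hi.ne' (div_ne_zero h4 (pow_ne_zero 2 h2)))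
  exact (Finset.sum_pos' (fun j _ ↦ hterm j) ⟨i, Finset.mem_univ i, hlt⟩).ne' hzero

end BmStructure
end BmContact

/-! ### Periodicity of integral curves in a compact one-dimensional set -/

namespace BmContact

section Recurrence

variable {M : Type*} [TopologicalSpace M] [ChartedSpace (EuclideanSpace ℝ (Fin 3)) M]

/-- Every point of `L` lies on a local integral curve of `X` which runs inside `L` and covers a
neighbourhood of the point in `L`: near each of its points, `L` is a one-dimensional orbit. -/
def IsLocallyOrbit (X : RawField M) (L : Set M) : Prop :=
  ∀ y ∈ L, ∃ γ : ℝ → M, γ 0 = y ∧ IsMIntegralCurveAt γ X 0 ∧ (∀ᶠ t in 𝓝 0, γ t ∈ L) ∧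
    𝓝[L] y ≤ map γ (𝓝 0)

variable {X : RawField M} {L : Set M}

theorem IsLocallyOrbit.exists_ball (h : IsLocallyOrbit X L) {y : M} (hy : y ∈ L) :
    ∃ δ > 0, ∃ γ : ℝ → M, γ 0 = y ∧ IsMIntegralCurveOn γ X (Ioo (-(2 * δ)) (2 * δ)) ∧
      MapsTo γ (Ioo (-(2 * δ)) (2 * δ)) L ∧ γ '' Ioo (-δ) δ ∈ 𝓝[L] y := by
  obtain ⟨γ, h0, hγ, hL, hn⟩ := h y hy
  obtain ⟨a, ha, hγa⟩ := isMIntegralCurveAt_iff'.1 hγ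
  obtain ⟨b, hb, hLb⟩ := Metric.eventually_nhds_iff_ball.1 hL
  have hsub : ∀ c, min a b ≤ c → Ioo (-(2 * (min a b / 2))) (2 * (min a b / 2)) ⊆ Metric.ball 0 c := by
    intro c hc t ht
    rw [Real.ball_eq_Ioo]
    exact ⟨by linarith [ht.1], by linarith [ht.2]⟩
  have hpos : 0 < min a b / 2 := by positivity
  exact ⟨min a b / 2, hpos, γ, h0, hγa.mono (hsub a (min_le_left _ _)),
    fun t ht ↦ hLb t (hsub b (min_le_right _ _) ht),
    hn (image_mem_map (Ioo_mem_nhds (neg_lt_zero.2 hpos) hpos))⟩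

theorem isMIntegralCurveOn_shift {γ : ℝ → M} {a b : ℝ} (hγ : IsMIntegralCurveOn γ X (Ioo a b)) (s : ℝ) :
    IsMIntegralCurveOn (fun t ↦ γ (t + s)) X (Ioo (a - s) (b - s)) := by
  have := hγ.comp_add s
  refine this.mono fun t ht ↦ ?_
  exact ⟨by linarith [ht.1], by linarith [ht.2]⟩

theorem IsLocallyOrbit.exists_uniform_time (h : IsLocallyOrbit X L) (hL : IsCompact L) :
    ∃ ε > 0, ∀ x ∈ L, ∃ γ : ℝ → M, γ 0 = x ∧ IsMIntegralCurveOn γ X (Ioo (-ε) ε) ∧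
      MapsTo γ (Ioo (-ε) ε) L := by
  refine hL.induction_on (p := fun S ↦ ∃ ε > 0, ∀ x ∈ S, ∃ γ : ℝ → M, γ 0 = x ∧
    IsMIntegralCurveOn γ X (Ioo (-ε) ε) ∧ MapsTo γ (Ioo (-ε) ε) L)
    ⟨1, one_pos, by simp⟩ ?_ ?_ ?_
  · rintro S T hST ⟨ε, hε, hT⟩
    exact ⟨ε, hε, fun x hx ↦ hT x (hST hx)⟩
  · rintro S T ⟨a, ha, hS⟩ ⟨b, hb, hT⟩
    have sub : ∀ c, min a b ≤ c → Ioo (-min a b) (min a b) ⊆ Ioo (-c) c :=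
      fun c hc ↦ Ioo_subset_Ioo (neg_le_neg hc) hc
    refine ⟨min a b, lt_min ha hb, fun x hx ↦ ?_⟩
    rcases hx with hx | hx
    · obtain ⟨γ, h0, h1, h2⟩ := hS x hx
      exact ⟨γ, h0, h1.mono (sub a (min_le_left _ _)), h2.mono_left (sub a (min_le_left _ _))⟩
    · obtain ⟨γ, h0, h1, h2⟩ := hT x hx
      exact ⟨γ, h0, h1.mono (sub b (min_le_right _ _)), h2.mono_left (sub b (min_le_right _ _))⟩
  · intro y hy
    obtain ⟨δ, hδ, γ, -, hγ, hγL, hn⟩ := h.exists_ball hy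
    refine ⟨_, hn, δ, hδ, ?_⟩
    rintro _ ⟨s, hs, rfl⟩
    have sub : Ioo (-δ) δ ⊆ Ioo (-(2 * δ) - s) (2 * δ - s) :=
      Ioo_subset_Ioo (by linarith [hs.1]) (by linarith [hs.2])
    refine ⟨fun t ↦ γ (t + s), by simp, (isMIntegralCurveOn_shift hγ s).mono sub, fun t ht ↦ hγL ?_⟩
    have := sub ht
    exact ⟨by linarith [this.1], by linarith [this.2]⟩

variable [IsManifold (𝓡 3) ∞ M]

theorem SmoothField.contMDiff_one (hX : SmoothField X) :
    ContMDiff (𝓡 3) (𝓡 3).tangent 1 (fun p ↦ (⟨p, X p⟩ : TangentBundle (𝓡 3) M)) :=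
  (show ContMDiff _ _ _ _ from hX).of_le (by simp)

variable [T2Space M]

/-- Two integral curves in `L` which meet can be joined to one integral curve in `L`. -/
theorem exists_extension (hX : SmoothField X) {γ γ' : ℝ → M} {a b a' b' t₀ : ℝ}
    (hγ : IsMIntegralCurveOn γ X (Ioo a b)) (hγ' : IsMIntegralCurveOn γ' X (Ioo a' b'))
    (hL : MapsTo γ (Ioo a b) L) (hL' : MapsTo γ' (Ioo a' b') L)
    (ht : t₀ ∈ Ioo a b ∩ Ioo a' b') (h : γ t₀ = γ' t₀) :
    ∃ η : ℝ → M, EqOn η γ (Ioo a b) ∧ IsMIntegralCurveOn η X (Ioo a b ∪ Ioo a' b') ∧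
      MapsTo η (Ioo a b ∪ Ioo a' b') L := by
  classical
  have : IsManifold (𝓡 3) 1 M := inferInstance
  refine ⟨piecewise (Ioo a b) γ γ', piecewise_eqOn _ _ _,
    isMIntegralCurveOn_piecewise hX.contMDiff_one hγ hγ' ht h, fun t htt ↦ ?_⟩
  by_cases hm : t ∈ Ioo a b
  · rw [piecewise_eq_of_mem _ _ _ hm]; exact hL hm
  · rw [piecewise_eq_of_notMem _ _ _ hm]; exact hL' (htt.resolve_left hm)

/-- A curve can be prolonged at both ends by a fixed time, and hence indefinitely. -/
theorem IsLocallyOrbit.exists_isMIntegralCurve (h : IsLocallyOrbit X L) (hL : IsCompact L)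
    (hX : SmoothField X) {x : M} (hx : x ∈ L) :
    ∃ γ : ℝ → M, γ 0 = x ∧ IsMIntegralCurve γ X ∧ ∀ t, γ t ∈ L := by
  have : IsManifold (𝓡 3) 1 M := inferInstance
  obtain ⟨ε, hε, H⟩ := h.exists_uniform_time hL
  have step : ∀ n : ℕ, ∃ γ : ℝ → M, γ 0 = x ∧
      IsMIntegralCurveOn γ X (Ioo (-(ε + n * (ε / 2))) (ε + n * (ε / 2))) ∧
      MapsTo γ (Ioo (-(ε + n * (ε / 2))) (ε + n * (ε / 2))) L := by
    intro n
    induction n with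
    | zero => simpa using H x hx
    | succ n ih =>
      obtain ⟨γ, h0, hγ, hγL⟩ := ih
      have hn : 0 ≤ n * (ε / 2) := by positivity
      set a := ε + n * (ε / 2) with ha
      have hr : a - ε / 2 ∈ Ioo (-a) a := ⟨by linarith, by linarith⟩
      have hl : -(a - ε / 2) ∈ Ioo (-a) a := ⟨by linarith, by linarith⟩
      obtain ⟨γ₁, h1, hγ₁, hL₁⟩ := H _ (hγL hr)
      obtain ⟨γ₂, h2, hγ₂, hL₂⟩ := H _ (hγL hl)
      have m₁ := isMIntegralCurveOn_shift hγ₁ (-(a - ε / 2))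
      have m₂ := isMIntegralCurveOn_shift hγ₂ (a - ε / 2)
      obtain ⟨η, e, hη, hηL⟩ := exists_extension hX hγ m₁ hγL
        (fun t ht ↦ hL₁ ⟨by linarith [ht.1], by linarith [ht.2]⟩)
        (t₀ := a - ε / 2) ⟨hr, by constructor <;> linarith⟩ (by simp [h1])
      have sub : Ioo (-a) (a + ε / 2) ⊆ Ioo (-a) a ∪ Ioo (-ε - -(a - ε / 2)) (ε - -(a - ε / 2)) :=
        Ioo_subset_Ioo_union_Ioo le_rfl (by linarith) (by linarith)
      obtain ⟨ζ, e', hζ, hζL⟩ := exists_extension hX (hη.mono sub) m₂ (hηL.mono_left sub)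
        (fun t ht ↦ hL₂ ⟨by linarith [ht.1], by linarith [ht.2]⟩)
        (t₀ := -(a - ε / 2)) ⟨by constructor <;> linarith, by constructor <;> linarith⟩
        (by rw [e hl]; simp [h2])
      have sub' : Ioo (-(a + ε / 2)) (a + ε / 2) ⊆
          Ioo (-a) (a + ε / 2) ∪ Ioo (-ε - (a - ε / 2)) (ε - (a - ε / 2)) := by
        rw [union_comm]
        exact Ioo_subset_Ioo_union_Ioo (by linarith) (by linarith) le_rfl
      have e1 : ε + ((n + 1 : ℕ) : ℝ) * (ε / 2) = a + ε / 2 := by push_cast; rw [ha]; ring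
      rw [e1]
      refine ⟨ζ, ?_, hζ.mono sub', hζL.mono_left sub'⟩
      rw [e' ⟨by linarith, by linarith⟩, e ⟨by linarith, by linarith⟩, h0]
  have key : ∀ a : ℝ, ∃ γ : ℝ → M, γ 0 = x ∧ IsMIntegralCurveOn γ X (Ioo (-a) a) ∧
      MapsTo γ (Ioo (-a) a) L := by
    intro a
    obtain ⟨n, hn⟩ := exists_nat_gt (a / (ε / 2))
    have hn' : a < n * (ε / 2) := (div_lt_iff₀ (by positivity)).1 hn
    obtain ⟨γ, h0, hγ, hγL⟩ := step n
    have sub : Ioo (-a) a ⊆ Ioo (-(ε + n * (ε / 2))) (ε + n * (ε / 2)) :=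
      Ioo_subset_Ioo (by linarith) (by linarith)
    exact ⟨γ, h0, hγ.mono sub, hγL.mono_left sub⟩
  choose γ h0 hγ hγL using key
  refine ⟨fun t ↦ γ (|t| + 1) t, h0 _, isMIntegralCurve_abs_add_one_of_isMIntegralCurveOn_Ioo
    hX.contMDiff_one γ h0 (fun a _ ↦ hγ a), fun t ↦ hγL _ ?_⟩
  exact abs_lt.1 (lt_add_one _)

/-- An integral curve in the compact set `L` returns infinitely often to a neighbourhood of an
accumulation point `y`. There `L` is a single arc of orbit, so two of the returns lie on it, and
the curve passes through `y` at two different times. -/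
theorem IsLocallyOrbit.exists_periodic (h : IsLocallyOrbit X L) (hL : IsCompact L)
    (hX : SmoothField X) {γ : ℝ → M} (hγ : IsMIntegralCurve γ X) (hγL : ∀ t, γ t ∈ L) :
    ∃ T > 0, Function.Periodic γ T := by
  have : IsManifold (𝓡 3) 1 M := inferInstance
  obtain ⟨y, hy, hc⟩ := hL.exists_mapClusterPt (f := atTop) (u := fun n : ℕ ↦ γ n)
    (tendsto_principal.2 (Eventually.of_forall fun n ↦ hγL n))
  obtain ⟨δ, hδ, γ', h0, hγ', -, hn⟩ := h.exists_ball hy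
  obtain ⟨U, hU, hUs⟩ := mem_nhdsWithin_iff_exists_mem_nhds_inter.1 hn
  have hfr : ∃ᶠ n : ℕ in atTop, γ n ∈ U := hc.frequently hU
  have ret : ∀ a : ℝ, ∃ t > a, γ t = y := by
    intro a
    obtain ⟨n, hn, hnU⟩ := (frequently_atTop.1 hfr) (⌈a + δ⌉₊)
    obtain ⟨s, hs, hsn⟩ := hUs ⟨hnU, hγL n⟩
    have hna : a + δ ≤ n := (Nat.le_ceil _).trans (by exact_mod_cast hn)
    refine ⟨n - s, by linarith [hs.2], ?_⟩
    have e := isMIntegralCurveOn_Ioo_eqOn_of_contMDiff_boundaryless (t₀ := s) (a := -(2 * δ))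
      (b := 2 * δ) ⟨by linarith [hs.1], by linarith [hs.2]⟩ hX.contMDiff_one hγ'
      ((hγ.comp_add (n - s)).isMIntegralCurveOn _) (by simp [hsn])
    have := e (x := 0) ⟨by linarith, by linarith⟩
    simpa [h0] using this.symm
  obtain ⟨a, -, ha⟩ := ret 0
  obtain ⟨b, hab, hb⟩ := ret a
  exact ⟨b - a, sub_pos.2 hab, hγ.periodic_of_eq hX.contMDiff_one (hb.trans ha.symm)⟩

theorem IsLocallyOrbit.exists_isPeriodicOrbit (h : IsLocallyOrbit X L) (hL : IsCompact L)
    (hX : SmoothField X) {x : M} (hx : x ∈ L) (h0 : X x ≠ 0) :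
    ∃ O, IsPeriodicOrbit X O ∧ O.Nonempty ∧ O ⊆ L := by
  obtain ⟨γ, hγ0, hγ, hγL⟩ := h.exists_isMIntegralCurve hL hX hx
  obtain ⟨T, hT, hper⟩ := h.exists_periodic hL hX hγ hγL
  refine ⟨range γ, ⟨γ, T, hγ, hT, hper, ?_, rfl⟩, range_nonempty γ, by rintro _ ⟨t, rfl⟩; exact hγL t⟩
  by_contra! hconst
  have hd := hγ 0
  have hcst : γ = fun _ ↦ x := by ext t; rw [hconst t 0, hγ0]
  subst hcst
  have := congrArg (fun A ↦ A (1 : ℝ)) (hd.mfderiv.symm.trans mfderiv_const)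
  exact h0 ((one_smul ℝ (X x)).symm.trans this)

end Recurrence

end BmContact

/-! ### The levels of `α(f^m N)` consist of periodic orbits -/

namespace BmContact

section Arc

variable {M : Type*} [TopologicalSpace M] [ChartedSpace (EuclideanSpace ℝ (Fin 3)) M]

theorem hasDerivAt_comp_curve (g : SmoothFun M) {γ : ℝ → M} {t : ℝ}
    (hγ : MDifferentiableAt 𝓘(ℝ, ℝ) (𝓡 3) γ t) :
    HasDerivAt (fun s ↦ g (γ s)) (mvfderiv (𝓡 3) g (γ t) (mfderiv 𝓘(ℝ, ℝ) (𝓡 3) γ t (1 : ℝ))) t := by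
  have h := (smoothFun_mdifferentiableAt g (γ t)).hasMFDerivAt.comp t hγ.hasMFDerivAt
  let A : ℝ →L[ℝ] ℝ := (mfderiv (𝓡 3) 𝓘(ℝ, ℝ) g (γ t)).comp (mfderiv 𝓘(ℝ, ℝ) (𝓡 3) γ t)
  have hA : HasFDerivAt (g ∘ γ) A t := hasMFDerivAt_iff_hasFDerivAt.1 h
  exact hA.hasDerivAt

variable [IsManifold (𝓡 3) ∞ M] {X : RawField M}

theorem isClosed_zeros [T2Space M] [SecondCountableTopology M] (hX : SmoothField X) :
    IsClosed {q | X q = 0} := by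
  rw [← isOpen_compl_iff, isOpen_iff_mem_nhds]
  intro p hp
  let v : EuclideanSpace ℝ (Fin 3) := X p
  have hv : v ≠ 0 := hp
  obtain ⟨ℓ, hℓ⟩ := SeparatingDual.exists_ne_zero (R := ℝ) hv
  obtain ⟨h, hh⟩ := exists_smoothFun_mvfderiv_eq p ℓ
  have hc : ContinuousAt (along X h) p := (smooth_along hX h.contMDiff.contMDiffAt).continuousAt
  have hne : along X h p ≠ 0 := by rw [along, hh]; exact hℓ
  filter_upwards [hc.eventually_ne hne] with q hq h0
  exact hq (along_of_field_eq_zero _ h0)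

namespace Frame

variable (Φ : Frame M)

/-- The line through the point with the first two coordinates `a` and `b`, in the direction of the
third coordinate. -/
def line (a b s : ℝ) : M := Φ.chart.symm (a, b, s)

variable {a b s : ℝ}

theorem line_mem_source (h : (a, b, s) ∈ Φ.chart.target) : Φ.line a b s ∈ Φ.chart.source :=
  Φ.chart.map_target h

theorem coord_line (h : (a, b, s) ∈ Φ.chart.target) : Φ.coord 0 (Φ.line a b s) = a ∧
    Φ.coord 1 (Φ.line a b s) = b ∧ Φ.coord 2 (Φ.line a b s) = s := by
  have := Φ.chart_eq _ (Φ.line_mem_source h)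
  rw [line, Φ.chart.right_inv h] at this
  simp only [coordMap, Prod.mk.injEq] at this
  exact ⟨this.1.symm, this.2.1.symm, this.2.2.symm⟩

theorem line_coord {q : M} (hq : q ∈ Φ.chart.source) :
    Φ.line (Φ.coord 0 q) (Φ.coord 1 q) (Φ.coord 2 q) = q := by
  have := Φ.chart.left_inv hq
  rwa [Φ.chart_eq q hq] at this

theorem mem_target_of_mem_source {q : M} (hq : q ∈ Φ.chart.source) :
    (Φ.coord 0 q, Φ.coord 1 q, Φ.coord 2 q) ∈ Φ.chart.target := by
  have := Φ.chart.map_source hq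
  rwa [Φ.chart_eq q hq] at this

theorem contMDiffAt_line (h : (a, b, s) ∈ Φ.chart.target) :
    ContMDiffAt 𝓘(ℝ, ℝ) (𝓡 3) ∞ (Φ.line a b) s := by
  have h1 : ContMDiffAt 𝓘(ℝ, ℝ) 𝓘(ℝ, ℝ × ℝ × ℝ) ∞ (fun s : ℝ ↦ (a, b, s)) s := by
    apply ContDiffAt.contMDiffAt
    fun_prop
  exact ContMDiffAt.comp s (Φ.contMDiffOn_symm.contMDiffAt (Φ.chart.open_target.mem_nhds h)) h1

theorem eventually_mem_target (h : (a, b, s) ∈ Φ.chart.target) :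
    ∀ᶠ r in 𝓝 s, (a, b, r) ∈ Φ.chart.target := by
  have hc : ContinuousAt (fun r : ℝ ↦ (a, b, r)) s := by fun_prop
  exact hc.eventually_mem (Φ.chart.open_target.mem_nhds h)

/-- If a set `L` is, near one of its points, a coordinate line of a frame, and `X` is tangent to this
line and does not vanish at the point, then the line is traversed by an integral curve of `X`, found
by solving the ordinary differential equation for the third coordinate. -/
theorem exists_integralCurve (hX : SmoothField X) {L : Set M} {p : M}
    (hp : p ∈ Φ.chart.source) (hpL : p ∈ L)
    (hL : ∀ᶠ q in 𝓝 p, q ∈ L ↔ Φ.coord 0 q = Φ.coord 0 p ∧ Φ.coord 1 q = Φ.coord 1 p)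
    (h0 : ∀ q ∈ L, along X (Φ.coord 0) q = 0) (h1 : ∀ q ∈ L, along X (Φ.coord 1) q = 0)
    (hXp : X p ≠ 0) :
    ∃ γ : ℝ → M, γ 0 = p ∧ IsMIntegralCurveAt γ X 0 ∧ (∀ᶠ t in 𝓝 0, γ t ∈ L) ∧
      𝓝[L] p ≤ map γ (𝓝 0) := by
  set a := Φ.coord 0 p with ha
  set b := Φ.coord 1 p with hb
  set c := Φ.coord 2 p with hc
  have hpt : (a, b, c) ∈ Φ.chart.target := Φ.mem_target_of_mem_source hp
  have hlc : Φ.line a b c = p := Φ.line_coord hp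
  have hcont : ContinuousAt (Φ.line a b) c := (Φ.contMDiffAt_line hpt).continuousAt
  let r : ℝ → ℝ := fun s ↦ along X (Φ.coord 2) (Φ.line a b s)
  have hr : ContDiffAt ℝ 1 r c := by
    have h := (smooth_along hX ((Φ.coord 2).contMDiff.contMDiffAt (x := Φ.line a b c))).comp c
      (Φ.contMDiffAt_line hpt)
    exact h.contDiffAt.of_le (by simp)
  obtain ⟨σ, hσ0, ε, hε, hσ⟩ :=
    hr.exists_forall_mem_closedBall_exists_eq_forall_mem_Ioo_hasDerivAt₀ 0
  have hσ' : ∀ᶠ t in 𝓝 (0 : ℝ), HasDerivAt σ (r (σ t)) t := by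
    filter_upwards [Ioo_mem_nhds (show 0 - ε < 0 by linarith) (show 0 < 0 + ε by linarith)]
      with t ht using hσ t ht
  have hσc : Tendsto σ (𝓝 0) (𝓝 c) := by
    have := hσ'.self_of_nhds.continuousAt.tendsto
    rwa [hσ0] at this
  -- the line lies in `L` near `p`
  have hline : ∀ᶠ s in 𝓝 c, (a, b, s) ∈ Φ.chart.target ∧ Φ.line a b s ∈ L := by
    have hL' := hcont.eventually (by rw [hlc]; exact hL)
    filter_upwards [Φ.eventually_mem_target hpt, hL'] with s hs hsL
    exact ⟨hs, hsL.2 ⟨(Φ.coord_line hs).1, (Φ.coord_line hs).2.1⟩⟩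
  refine ⟨fun t ↦ Φ.line a b (σ t), by simp only [hσ0, hlc], ?_, ?_, ?_⟩
  · filter_upwards [hσ', (hσc.eventually hline), hσ'.eventually_nhds,
      (hσc.eventually hline).eventually_nhds] with t hd ⟨ht, htL⟩ hdn htn
    have hm : MDifferentiableAt 𝓘(ℝ, ℝ) (𝓡 3) (fun t ↦ Φ.line a b (σ t)) t :=
      ((Φ.contMDiffAt_line ht).mdifferentiableAt (by simp)).comp t
        hd.differentiableAt.mdifferentiableAt
    have hcd := fun j ↦ hasDerivAt_comp_curve (Φ.coord j) hm
    have key : mfderiv 𝓘(ℝ, ℝ) (𝓡 3) (fun t ↦ Φ.line a b (σ t)) t (1 : ℝ) =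
        X (Φ.line a b (σ t)) := by
      refine sub_eq_zero.1 (Φ.eq_zero _ (Φ.line_mem_source ht) _ fun j ↦ ?_)
      rw [map_sub, sub_eq_zero]
      change _ = along X (Φ.coord j) _
      fin_cases j
      · refine ((hcd 0).unique ?_).trans (h0 _ htL).symm
        refine (hasDerivAt_const t a).congr_of_eventuallyEq ?_
        filter_upwards [htn] with s hs using (Φ.coord_line hs.1).1
      · refine ((hcd 1).unique ?_).trans (h1 _ htL).symm
        refine (hasDerivAt_const t b).congr_of_eventuallyEq ?_
        filter_upwards [htn] with s hs using (Φ.coord_line hs.1).2.1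
      · refine (hcd 2).unique (hd.congr_of_eventuallyEq ?_)
        filter_upwards [htn] with s hs using (Φ.coord_line hs.1).2.2
    have e : mfderiv 𝓘(ℝ, ℝ) (𝓡 3) (fun t ↦ Φ.line a b (σ t)) t =
        (1 : ℝ →L[ℝ] ℝ).smulRight (X (Φ.line a b (σ t))) := by
      refine ContinuousLinearMap.ext_ring ?_
      exact key.trans (one_smul ℝ _).symm
    have := hm.hasMFDerivAt
    rwa [e] at this
  · exact (hσc.eventually hline).mono fun t ht ↦ ht.2
  · -- the third coordinate has nonzero speed, so it fills a neighbourhood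
    have hrc : r c ≠ 0 := by
      intro hrc
      refine hXp (Φ.eq_zero p hp _ fun j ↦ ?_)
      fin_cases j
      · exact h0 p hpL
      · exact h1 p hpL
      · have : along X (Φ.coord 2) (Φ.line a b c) = 0 := hrc
        rwa [hlc] at this
    have hst : HasStrictDerivAt σ (r (σ 0)) 0 :=
      hasStrictDerivAt_of_hasDerivAt_of_continuousAt hσ'
        (ContinuousAt.comp (g := r) (f := σ) (by rw [hσ0]; exact hr.continuousAt)
          hσ'.self_of_nhds.continuousAt)
    have hmap := hst.map_nhds_eq (by rwa [hσ0])
    rw [hσ0] at hmap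
    change 𝓝[L] p ≤ map (Φ.line a b ∘ σ) (𝓝 0)
    rw [← Filter.map_map, hmap]
    have ht2 : Tendsto (Φ.coord 2) (𝓝[L] p) (𝓝 c) :=
      (Φ.coord 2).contMDiff.continuous.continuousAt.tendsto.mono_left nhdsWithin_le_nhds
    have heq : Φ.line a b ∘ Φ.coord 2 =ᶠ[𝓝[L] p] id := by
      filter_upwards [nhdsWithin_le_nhds hL, self_mem_nhdsWithin,
        nhdsWithin_le_nhds (Φ.chart.open_source.mem_nhds hp)] with q hq hqL hqs
      obtain ⟨e0, e1⟩ := hq.1 hqL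
      have := Φ.line_coord hqs
      rwa [e0, e1] at this
    calc 𝓝[L] p = map (Φ.line a b ∘ Φ.coord 2) (𝓝[L] p) := by
          rw [Filter.map_congr heq, Filter.map_id]
      _ ≤ map (Φ.line a b) (𝓝 c) := by
          rw [← Filter.map_map]; exact Filter.map_mono ht2

end Frame

end Arc

namespace BmStructure

variable {M : Type*} [TopologicalSpace M] [ChartedSpace (EuclideanSpace ℝ (Fin 3)) M]
  [IsManifold (𝓡 3) ∞ M] {B : BmStructure M} {α : B.OneForms} {R : B.VectorFields}

theorem Transverse.along_F_eq_zero (D : B.Transverse) (X : B.VectorFields) {p : M} (hp : p ∈ B.Z) :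
    along (X : RawField M) D.F p = 0 := by
  obtain ⟨-, g, hg⟩ := D.mem_vectorFields_iff.1 X.2
  rw [hg.self_of_nhdsSet p hp, D.F_eq_zero hp, zero_pow (Nat.one_le_iff_ne_zero.1 B.one_le_m),
    zero_mul]

/-- The level `α(f^m N) = c` in the critical surface. -/
def level (α : B.OneForms) (D : B.Transverse) (c : ℝ) : Set M := {q ∈ B.Z | α D.E q = c}

theorem isCompact_level (hZ : IsCompact B.Z) (D : B.Transverse) (c : ℝ) :
    IsCompact (level α D c) :=
  hZ.inter_right (isClosed_singleton.preimage (α D.E).contMDiff.continuous)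

section

variable [T2Space M] [SecondCountableTopology M]

/-- Away from the zeros of the Reeb field, the defining function and `α(f^m N)` are two of the
coordinates of a chart. -/
theorem exists_frame_level (hα : IsContactForm α) (hR : IsReebField α R) (D : B.Transverse) {p : M}
    (hp : p ∈ B.Z) (h0 : (R : RawField M) p ≠ 0) :
    ∃ Φ : Frame M, Φ.coord 0 = D.F ∧ Φ.coord 1 = α D.E ∧ p ∈ Φ.chart.source := by
  obtain ⟨W, hW, hWu⟩ := exists_along_ne_zero hα hR D hp h0
  exact exists_frame_of_two D.F (α D.E) p (mvfderiv_ne_zero D.F_eq hp)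
    (hW.self_of_nhdsSet p hp) hWu

/-- In a chart with first coordinates `f` and `α(f^m N)`, the level is a coordinate line, and the
Reeb field is tangent to it. -/
theorem isLocallyOrbit_level (hα : IsContactForm α) (hR : IsReebField α R) (D : B.Transverse) {c : ℝ}
    (hc : ∀ q ∈ level α D c, (R : RawField M) q ≠ 0) :
    IsLocallyOrbit (R : RawField M) (level α D c) := by
  rintro p ⟨hp, rfl⟩
  have hRp := hc p ⟨hp, rfl⟩
  obtain ⟨Φ, e0, e1, hpΦ⟩ := exists_frame_level hα hR D hp hRp
  refine Φ.exists_integralCurve R.2.1 hpΦ ⟨hp, rfl⟩ ?_ (fun q hq ↦ ?_) (fun q hq ↦ ?_) hRp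
  · filter_upwards [D.F_eq_zero_iff.filter_mono (nhds_le_nhdsSet hp)] with q hq
    rw [e0, e1, D.F_eq_zero hp, hq]
    rfl
  · rw [e0]; exact D.along_F_eq_zero R hq.1
  · rw [e1]; exact along_reeb_eq_zero hR D hq.1

/-- At a point of `Z` where the Reeb field does not vanish, the function `α(f^m N)` on `Z` is a
submersion, so it takes all values close to its value there. -/
theorem eventually_level_nonempty (hα : IsContactForm α) (hR : IsReebField α R) (D : B.Transverse)
    {p : M} (hp : p ∈ B.Z) (h0 : (R : RawField M) p ≠ 0) :
    ∀ᶠ c in 𝓝 (α D.E p), (level α D c).Nonempty := by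
  obtain ⟨Φ, e0, e1, hpΦ⟩ := exists_frame_level hα hR D hp h0
  have ht := Φ.mem_target_of_mem_source hpΦ
  have hl := Φ.line_coord hpΦ
  rw [e0, e1, D.F_eq_zero hp] at ht hl
  have hc : ContinuousAt (fun c : ℝ ↦ ((0 : ℝ), c, Φ.coord 2 p)) (α D.E p) := by fun_prop
  have hs : ContinuousAt (fun c : ℝ ↦ Φ.line 0 c (Φ.coord 2 p)) (α D.E p) :=
    ContinuousAt.comp (Φ.chart.continuousAt_symm ht) hc
  have hs' := hs.tendsto
  rw [hl] at hs'
  have hZ := hs'.eventually (D.F_eq_zero_iff.filter_mono (nhds_le_nhdsSet hp))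
  filter_upwards [hc.eventually_mem (Φ.chart.open_target.mem_nhds ht), hZ] with c h1 h2
  obtain ⟨c0, c1, -⟩ := Φ.coord_line h1
  rw [e0] at c0
  rw [e1] at c1
  exact ⟨_, h2.1 c0, c1⟩

/-- The zeros of the Reeb field on `Z` form a compact set, on which `α(f^m N)` does not vanish. -/
theorem eventually_reeb_ne_zero_on_level (hZ : IsCompact B.Z) (hR : IsReebField α R)
    (D : B.Transverse) : ∀ᶠ c in 𝓝 (0 : ℝ), ∀ q ∈ level α D c, (R : RawField M) q ≠ 0 := by
  have hK : IsCompact (B.Z ∩ {q | (R : RawField M) q = 0}) := hZ.inter_right (isClosed_zeros R.2.1)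
  have hcl := (hK.image (α D.E).contMDiff.continuous).isClosed
  have h0 : (0 : ℝ) ∉ α D.E '' (B.Z ∩ {q | (R : RawField M) q = 0}) := by
    rintro ⟨q, ⟨hq, hRq⟩, h⟩
    exact form_E_ne_zero_of_reeb_eq_zero hR D hq hRq h
  filter_upwards [hcl.isOpen_compl.mem_nhds h0] with c hc q hq hRq
  exact hc ⟨q, ⟨hq.1, hRq⟩, hq.2⟩

end

theorem infinite_setOf_isPeriodicOrbit {M : Type*} [TopologicalSpace M] [T2Space M]
    [SecondCountableTopology M] [ChartedSpace (EuclideanSpace ℝ (Fin 3)) M] [IsManifold (𝓡 3) ∞ M]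
    {B : BmStructure M} (hZ : IsCompact B.Z) (hne : B.Z.Nonempty) {α : B.OneForms}
    (hα : IsContactForm α) {R : B.VectorFields} (hR : IsReebField α R) :
    {O : Set M | IsPeriodicOrbit (R : RawField M) O ∧ O ⊆ B.Z}.Infinite := by
  obtain ⟨D⟩ := exists_transverse B
  obtain ⟨p, hp, hup⟩ := exists_form_E_eq_zero hZ hne hα D
  have hRp : (R : RawField M) p ≠ 0 := fun h ↦ form_E_ne_zero_of_reeb_eq_zero hR D hp h hup
  have hreg := eventually_reeb_ne_zero_on_level hZ hR D
  have hnon := eventually_level_nonempty hα hR D hp hRp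
  rw [hup] at hnon
  have horb : ∀ c ∈ {c | (level α D c).Nonempty ∧ ∀ q ∈ level α D c, (R : RawField M) q ≠ 0},
      ∃ O, IsPeriodicOrbit (R : RawField M) O ∧ O.Nonempty ∧ O ⊆ level α D c := by
    rintro c ⟨⟨q, hq⟩, hc⟩
    exact (isLocallyOrbit_level hα hR D hc).exists_isPeriodicOrbit (isCompact_level hZ D c) R.2.1 hq
      (hc q hq)
  choose! O hO hOne hOL using horb
  refine Set.infinite_of_injOn_mapsTo (f := O) (fun c hc c' hc' h ↦ ?_)
    (fun c hc ↦ ⟨hO c hc, (hOL c hc).trans fun q hq ↦ hq.1⟩)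
    (infinite_of_mem_nhds (0 : ℝ) (hnon.and hreg))
  -- distinct levels are disjoint
  obtain ⟨q, hq⟩ := hOne c hc
  exact (hOL c hc hq).2.symm.trans (hOL c' hc' (h ▸ hq)).2

end BmStructure

end BmContact

end

theorem mainTheorem4 {M : Type*} [TopologicalSpace M] [T2Space M] [SecondCountableTopology M]
    [ChartedSpace (EuclideanSpace ℝ (Fin 3)) M] [IsManifold (𝓡 3) ∞ M]
    (B : BmContact.BmStructure M) (hZ : IsCompact B.Z) (hne : B.Z.Nonempty)
    (α : B.OneForms) (hα : BmContact.BmStructure.IsContactForm α)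
    (R : B.VectorFields) (hR : BmContact.BmStructure.IsReebField α R) :
    {O : Set M | BmContact.IsPeriodicOrbit (R : BmContact.RawField M) O ∧ O ⊆ B.Z}.Infinite := by
  exact BmContact.BmStructure.infinite_setOf_isPeriodicOrbit hZ hne hα hR
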